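/- **Setting.** Fix $r\ge 3$; $n$ ranges over multiples of $r$, $V=[n]$, $\mathcal K=\binom{V}{r}$. An $r$-graph $h$ on a vertex set $W\subseteq V$ is a set of $r$-subsets of $W$; $d_h(x)$ and $d_h(x,y)$ are degree and codegree, $D_h=r|h|/|W|$ is the average degree, $h-Z=\{A\in h:A\cap Z=\emptyset\}$ (an $r$-graph on $W\setminus Z$), $\Phi(h)$ is the number of perfect matchings ($|W|/r$ pairwise disjoint edges), and $w_h(U)=\Phi(h-U)$. Write $a=(1\pm\theta)b$ for $|a-b|\le\theta b$; "for $\theta$-almost every" means for all but at most a $\theta$-fraction. Let $\varepsilon>0$ be fixed, $\theta=\theta(n)\to0$ (one function bounding all the $o(1)$ terms below), $C,c,\eta>0$ constants, and $\omega=\omega(n)\to\infty$ with $\omega=o(\log n)$. Let $M\in\mathbb N$ and $\delta_x\in\mathbb N$ ($x\in V$) satisfy $M=(1\pm\theta)\frac nr\log n$ and $\delta_x=(1\pm\theta)\varepsilon\log n$. Let $\mathcal L$ be the set of $h\subseteq\mathcal K$ with $d_h(x)\ge\delta_x$ for all $x$, and $T=|\mathcal K|-M$. Choose $\mathbf H_T$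 uniformly from the $M$-edge members of $\mathcal L$, let $A_1,\dots,A_T$ be a uniform ordering of $\mathcal K\setminus\mathbf H_T$, and set $\mathbf H_t=\mathcal K\setminus\{A_1,\dots,A_t\}$. For $h\subseteq\mathcal K$ let $\beta(h)$ be the probability that a uniform $M$-subset of $h$ is in $\mathcal L$; for $Z\subseteq V$ let $\bar\varphi_Z(h)$ be the average of $\beta(h')$ over all $h'\subseteq\mathcal K$ with $|h'|=|h|$ and $h'-Z=h-Z$; put $\delta=\varepsilon\log(3/\varepsilon)$ and call $J\subseteq\mathcal K$ *anemic* if at least $2rn^{2\delta}$ vertices have degree less than $2\varepsilon\log n$ in $J$. For $Z\in\mathcal K$ let $\mathfrak D_Z$ be the set of $h$ with $\sum_{y\in V\setminus Z}(\delta_y-d_{h-Z}(y))^+>\omega$. **Property $\mathfrak R$.** An $h\subseteq\mathcal K$ with $|h|=|\mathcal K|-t$ satisfies $\mathfrak R$ if * $d_h(x)=(1\pm\theta)D_h$ for $\theta$-almost every $x\in V$; $c\,\varepsilon D_h\le d_h(x)\le C D_h$ for all $x$; and $d_h(x,y)\le\theta D_h$ for all $x\ne y$; * if $|h|>2rM$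 then $d_h(x)>2\varepsilon D_h$ for all $x$; * $\bar\varphi_Z(h)>n^{-(2r+1)}\beta(\mathcal K)$ for all $Z\in\{\emptyset\}\cup\mathcal K$; * the random subset of $h$ containing each edge independently with probability $M/|h|$ is anemic with probability less than $\exp[-(1-\theta)n^{2\delta}]$; * $\mathbb P(\mathbf H_T\in\mathfrak D_Z\mid \mathbf H_t-Z=h-Z)<n^{-\eta\omega/2}$ for all $Z\in\mathcal K$. **Property $\mathfrak F$.** An $r$-graph $g$ on $W$ satisfies $\mathfrak F$ if $w_g(U)=(1\pm\theta)\Phi(g)/D_g$ for $\theta$-almost every $r$-subset $U$ of $W$. **Lemma.** For each $r\ge3$ there is $\varepsilon_0>0$ such that the following holds for every $0<\varepsilon<\varepsilon_0$ and all $C,c,\eta,\theta,\omega$ as above. There is $\theta'=\theta'(n)\to0$, depending only on $r,\varepsilon,C,c,\eta,\theta,\omega$, such that for every $k\in\mathbb N$, all sufficiently large $n$ divisible by $r$, all $M$ and $(\delta_x)$ as above, all $t$ with $1\le t\le T$, and all $x\in Z\in\mathcal K$, the probability that $$\mathbf H_t\text{ satisfies }\mathfrak R\quad\text{and}\quad \mathbf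 H_t-Z\text{ satisfies }\mathfrak F,$$ but it is **not** the case that $$w_{\mathbf H_t}\big((Z\setminus\{x\})\cup\{y\}\big)\ \ge\ (1-\theta')\,\frac{w_{\mathbf H_t}(Z)\,d_{\mathbf H_t}(x)}{D_{\mathbf H_t}}\quad\text{for }\theta'\text{-almost every }y\in V\setminus Z,$$ is at most $n^{-k}$. -/

import Mathlib

open Filter Topology Asymptotics

namespace Shamir

/-- Sets of subsets of `[n]`; an `r`-graph on `W ⊆ [n]` is such an `h` contained in
`edgesOn r W`. -/
abbrev Hyp (n : ℕ) := Finset (Finset (Fin n))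

section Combinatorics

variable {n : ℕ}

/-- All `r`-subsets of `W`. -/
def edgesOn (r : ℕ) (W : Finset (Fin n)) : Hyp n := W.powersetCard r

/-- `h - Z`: the edges of `h` that avoid `Z`, a hypergraph on the vertices outside `Z`. -/
def remove (h : Hyp n) (Z : Finset (Fin n)) : Hyp n := h.filter fun A => Disjoint A Z

/-- The degree `d_h(x)`. -/
def deg (h : Hyp n) (x : Fin n) : ℕ := (h.filter fun A => x ∈ A).card

/-- The codegree `d_h(x, y)`. -/
def codeg (h : Hyp n) (x y : Fin n) : ℕ := (h.filter fun A => x ∈ A ∧ y ∈ A).card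

/-- The average degree of the `r`-graph `h` with vertex set `W`. -/
noncomputable def avgDeg (r : ℕ) (W : Finset (Fin n)) (h : Hyp n) : ℝ :=
  (r : ℝ) * h.card / W.card

/-- The perfect matchings of the `r`-graph `h` with vertex set `W`:
sets of `|W| / r` pairwise disjoint edges. -/
def perfectMatchings (r : ℕ) (W : Finset (Fin n)) (h : Hyp n) : Finset (Hyp n) :=
  h.powerset.filter fun μ =>
    (∀ A ∈ μ, ∀ B ∈ μ, A ≠ B → Disjoint A B) ∧ μ.card * r = W.card

/-- `Φ(h)`, for the `r`-graph `h` with vertex set `W`. -/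
def numPM (r : ℕ) (W : Finset (Fin n)) (h : Hyp n) : ℕ := (perfectMatchings r W h).card

/-- `w_h(U) = Φ(h - U)`, for the `r`-graph `h` with vertex set `W`. -/
def weight (r : ℕ) (W : Finset (Fin n)) (h : Hyp n) (U : Finset (Fin n)) : ℕ :=
  numPM r (W \ U) (remove h U)

end Combinatorics

section Probability

/-- The probability of the event `p` for a uniformly chosen element of the finite set `S`. -/
noncomputable def prob {Ω : Type*} (S : Finset Ω) (p : Ω → Prop) : ℝ :=
  open Classical in ((S.filter p).card : ℝ) / S.card

/-- The conditional probability of `p` given `q` for a uniform element of `S`. -/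
noncomputable def condProb {Ω : Type*} (S : Finset Ω) (p q : Ω → Prop) : ℝ :=
  open Classical in prob (S.filter q) p

/-- The probability that the random subset of `S` containing each element independently with
probability `α` has the property `p`. -/
noncomputable def binomProb {β : Type*} (S : Finset β) (α : ℝ) (p : Finset β → Prop) : ℝ :=
  open Classical in
  ∑ J ∈ S.powerset.filter p, α ^ J.card * (1 - α) ^ (S.card - J.card)

/-- `p` holds for all but at most a `θ`-fraction of the elements of `S`. -/
def AlmostAll {β : Type*} (θ : ℝ) (S : Finset β) (p : β → Prop) : Prop :=
  open Classical in ((S.filter fun a => ¬ p a).card : ℝ) ≤ θ * S.card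

/-- `a = (1 ± θ) b`. -/
def Approx (θ a b : ℝ) : Prop := |a - b| ≤ θ * b

end Probability

section Evolution

variable {n : ℕ}

/-- The length `T` of the process, when its last hypergraph has `M` edges. -/
def stopT (n r M : ℕ) : ℕ := n.choose r - M

/-- The class `ℒ` of hypergraphs in which every vertex `x` has degree at least `δ x`. -/
def MinDeg (δ : Fin n → ℕ) (h : Hyp n) : Prop := ∀ x, δ x ≤ deg h x

instance (δ : Fin n → ℕ) : DecidablePred (MinDeg δ) :=
  fun h => inferInstanceAs (Decidable (∀ x, δ x ≤ deg h x))

/-- The members of `ℒ` with exactly `M` edges. -/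
def finalGraphs (r M : ℕ) (δ : Fin n → ℕ) : Finset (Hyp n) :=
  ((edgesOn r Finset.univ).powersetCard M).filter (MinDeg δ)

/-- The sample space of the process: a pair `(J, A)` consists of the final hypergraph `J` and an
ordering `A` of the remaining `r`-sets. Each `J` has the same number `T!` of orderings, so for the
uniform measure `J` is uniform and, given `J`, the ordering is uniform. -/
def samples (r M : ℕ) (δ : Fin n → ℕ) :
    Finset (Hyp n × (Fin (stopT n r M) → Finset (Fin n))) :=
  Finset.univ.filter fun s =>
    s.1 ∈ finalGraphs r M δ ∧ Function.Injective s.2 ∧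
      Finset.univ.image s.2 = edgesOn r Finset.univ \ s.1

/-- The hypergraph `H_t`: all `r`-sets except the first `t` ones of the ordering. -/
def graphAt (r M t : ℕ) (s : Hyp n × (Fin (stopT n r M) → Finset (Fin n))) : Hyp n :=
  edgesOn r Finset.univ \ (Finset.univ.filter fun i : Fin (stopT n r M) => (i : ℕ) < t).image s.2

end Evolution

section Properties

variable {n : ℕ}

/-- Degree regularity `ℜ⁰`, with `o(1)`-terms `θ` and implied constants `C`, `c`. -/
structure PropR0 (r : ℕ) (ε θ C c : ℝ) (h : Hyp n) : Prop where
  almost_regular : AlmostAll θ Finset.univ fun x : Fin n =>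
    Approx θ (deg h x) (avgDeg r Finset.univ h)
  max_deg : ∀ x, (deg h x : ℝ) ≤ C * avgDeg r Finset.univ h
  min_deg : ∀ x, c * ε * avgDeg r Finset.univ h ≤ (deg h x : ℝ)
  max_codeg : ∀ x y, x ≠ y → (codeg h x y : ℝ) ≤ θ * avgDeg r Finset.univ h

/-- Minimum degree of the denser hypergraphs, `ℜ¹`. -/
def PropR1 (r M : ℕ) (ε : ℝ) (h : Hyp n) : Prop :=
  2 * r * M < h.card → ∀ x, 2 * ε * avgDeg r Finset.univ h < (deg h x : ℝ)

/-- `β(h)`: the probability that a uniform `M`-subset of `h` belongs to `ℒ`. -/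
noncomputable def beta (M : ℕ) (δ : Fin n → ℕ) (h : Hyp n) : ℝ :=
  prob (h.powersetCard M) (MinDeg δ)

/-- The `r`-graphs on `[n]` with as many edges as `h` that agree with `h` off `Z`. -/
def agreeOff (r : ℕ) (Z : Finset (Fin n)) (h : Hyp n) : Finset (Hyp n) :=
  ((edgesOn r Finset.univ).powersetCard h.card).filter fun h' => remove h' Z = remove h Z

/-- The average of `β` over the `r`-graphs on `[n]` with as many edges as `h` that agree with `h`
off `Z`. -/
noncomputable def avgBeta (r M : ℕ) (δ : Fin n → ℕ) (Z : Finset (Fin n)) (h : Hyp n) : ℝ :=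
  (∑ h' ∈ agreeOff r Z h, beta M δ h') / (agreeOff r Z h).card

/-- The lower bounds `ℜ²` on averages of `β`. -/
def PropR2 (r M : ℕ) (δ : Fin n → ℕ) (h : Hyp n) : Prop :=
  ∀ Z, Z = ∅ ∨ Z ∈ edgesOn r (Finset.univ : Finset (Fin n)) →
    ((n : ℝ) ^ (2 * r + 1))⁻¹ * beta M δ (edgesOn r Finset.univ) < avgBeta r M δ Z h

/-- The exponent `ε log (3 / ε)`. -/
noncomputable def smallExp (ε : ℝ) : ℝ := ε * Real.log (3 / ε)

/-- Having at least `2 r n ^ (2 ε log (3 / ε))` vertices of degree less than `2 ε log n`. -/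
def Anemic (r : ℕ) (ε : ℝ) (J : Hyp n) : Prop :=
  open Classical in
  2 * (r : ℝ) * (n : ℝ) ^ (2 * smallExp ε) ≤
    ((Finset.univ.filter fun x : Fin n => (deg J x : ℝ) < 2 * ε * Real.log n).card : ℝ)

/-- Random subsets of `h` of expected size `M` are rarely anemic, `ℜ³`, with `o(1)`-term `θ`. -/
def PropR3 (r M : ℕ) (ε θ : ℝ) (h : Hyp n) : Prop :=
  binomProb h ((M : ℝ) / h.card) (Anemic r ε) <
    Real.exp (-((1 - θ) * (n : ℝ) ^ (2 * smallExp ε)))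

/-- The event `𝔇_Z` that the total degree deficit of `h - Z` outside `Z` exceeds `ω`
(the subtraction is truncated, that is, it is the positive part of the difference). -/
def Deficient (δ : Fin n → ℕ) (ω : ℝ) (Z : Finset (Fin n)) (h : Hyp n) : Prop :=
  ω < ((∑ y ∈ Finset.univ \ Z, (δ y - deg (remove h Z) y) : ℕ) : ℝ)

/-- `ℜ⁴`: for each `r`-set `Z`, given that `H_t - Z = h - Z`, the final hypergraph `H_T` is unlikely
to be deficient with respect to `Z`. -/
def PropR4 (r M : ℕ) (δ : Fin n → ℕ) (ω η : ℝ) (t : ℕ) (h : Hyp n) : Prop :=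
  ∀ Z ∈ edgesOn r (Finset.univ : Finset (Fin n)),
    condProb (samples r M δ) (fun s => Deficient δ ω Z (graphAt r M (stopT n r M) s))
      (fun s => remove (graphAt r M t s) Z = remove h Z) < (n : ℝ) ^ (-(η * ω / 2))

/-- The property `ℜ` of a hypergraph `h` with `|h| = C(n,r) - t`. -/
structure PropR (r M : ℕ) (δ : Fin n → ℕ) (ε θ C c ω η : ℝ) (t : ℕ) (h : Hyp n) : Prop where
  r0 : PropR0 r ε θ C c h
  r1 : PropR1 r M ε h
  r2 : PropR2 r M δ h
  r3 : PropR3 r M ε θ h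
  r4 : PropR4 r M δ ω η t h

/-- The property `𝔉` of the `r`-graph `h` with vertex set `W`: `w_h(U) = (1 ± θ) Φ(h) / D_h` for all
but a `θ`-fraction of the `r`-subsets `U` of `W`. -/
def PropF (θ : ℝ) (r : ℕ) (W : Finset (Fin n)) (h : Hyp n) : Prop :=
  AlmostAll θ (edgesOn r W) fun U =>
    Approx θ (weight r W h U) ((numPM r W h : ℝ) / avgDeg r W h)

/-- For all but a `θ`-fraction of the `y` outside `Z`,
`w_h((Z ∖ x) ∪ y) ≥ (1 - θ) w_h(Z) d_h(x) / D_h`. -/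
def SwapBound (θ : ℝ) (r : ℕ) (h : Hyp n) (Z : Finset (Fin n)) (x : Fin n) : Prop :=
  AlmostAll θ (Finset.univ \ Z) fun y =>
    (1 - θ) * ((weight r Finset.univ h Z : ℝ) * deg h x / avgDeg r Finset.univ h) ≤
      (weight r Finset.univ h (insert y (Z.erase x)) : ℝ)

end Properties

end Shamir

/-!
Fix `Z`, `x ∈ Z` and `g = H_t - Z`, so that `Φ(g) = w(Z)`. Call an edge meeting `Z` in `x` only a
star edge. For `y ∉ Z`, every star edge `A` of `H_t` with `y ∉ A` extends the perfect matchings of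
`g` off `(A \ {x}) ∪ {y}` to perfect matchings of `H_t` off `(Z \ {x}) ∪ {y}`
(`sum_weight_le_weight`). By `𝔉`, almost all `r`-sets have weight about `Φ(g) / D_g` in `g`, so for
almost every `y` only a small proportion `γ` of all potential star edges are bad for `y`
(`almostAll_card_badStar_le`). By the bounds on degrees and codegrees almost all edges of `H_t` at
`x` are star edges, hence the swap inequality holds at `y` unless a proportion `γ'` of the star
edges of `H_t`, much larger than `γ`, are bad for `y` (`swap_le_weight`).

If the star edges of `H_t` were a uniformly random set of size `s`, that would have probability at
most about `2 ^ s γ ^ (γ' s)`, which is smaller than any power of `n` because `s` has order at least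
`log n` and `γ'` may be taken larger than `1 / log (1 / γ)` (`eventually_tolerance_bound`). The
process is conditioned on the minimum degrees of the final hypergraph, but this conditioning is
weak. Permutations of the star edges act on the samples and preserve `g`, `s` and the degrees of
the vertices of `Z`. Unless the final hypergraph is deficient for `Z`, which the last property in `ℜ` makes
improbable (`card_propR4_deficient_le`), the degrees outside `Z` are guaranteed by the positions of
at most `ω` star edges. Given these positions the others are still uniform, and since
`ω = o(log n)`, a union bound over the at most `4 ^ s` choices of these edges and of the other edges
mapped to bad ones is affordable (`card_permsOn_inter_le`, `card_act_inter_le`). Averaging over the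
orbits gives the result (`card_swapFailure_le`).
-/

namespace Shamir

/-! ### Counting permutations that map prescribed points into a small set -/

section Permutations

variable {α : Type*} [DecidableEq α] [Fintype α]

/-- The permutations of `α` that move only elements of `K`. -/
def permsOn (K : Finset α) : Finset (Equiv.Perm α) :=
  Finset.univ.filter fun π : Equiv.Perm α => ∀ a, a ∉ K → π a = a

lemma mem_permsOn {K : Finset α} {π : Equiv.Perm α} :
    π ∈ permsOn K ↔ ∀ a, a ∉ K → π a = a := by
  simp [permsOn]

lemma one_mem_permsOn (K : Finset α) : (1 : Equiv.Perm α) ∈ permsOn K := by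
  simp [mem_permsOn]

lemma permsOn_mul_swap {K : Finset α} {π : Equiv.Perm α} (hπ : π ∈ permsOn K) {a b : α}
    (ha : a ∈ K) (hb : b ∈ K) : π * Equiv.swap a b ∈ permsOn K := by
  rw [mem_permsOn] at *
  intro c hc
  rw [Equiv.Perm.mul_apply, Equiv.swap_apply_of_ne_of_ne, hπ c hc]
  · rintro rfl; exact hc ha
  · rintro rfl; exact hc hb

lemma permsOn_inv {K : Finset α} {π : Equiv.Perm α} (hπ : π ∈ permsOn K) :
    π⁻¹ ∈ permsOn K := by
  rw [mem_permsOn] at *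
  intro c hc
  rw [Equiv.Perm.inv_eq_iff_eq, hπ c hc]

lemma apply_mem_iff_of_permsOn {K : Finset α} {π : Equiv.Perm α} (hπ : π ∈ permsOn K) (a : α) :
    π a ∈ K ↔ a ∈ K := by
  have key : ∀ σ ∈ permsOn K, ∀ b, b ∉ K → σ b ∉ K := fun σ hσ b hb => by
    rwa [mem_permsOn.1 hσ b hb]
  constructor
  · intro h
    by_contra ha
    exact key π hπ a ha h
  · intro h
    by_contra ha
    exact key _ (permsOn_inv hπ) _ ha (by simpa using h)

open Classical in
/-- Under a condition that does not change when `a` is swapped with any point of `K` off `F`,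
the image of `a` is uniform enough to lie in `B` with probability at most `|B| / |K \ F|`. -/
lemma card_permsOn_apply_mem_le {K F B : Finset α} {a : α} (ha : a ∈ K)
    (Q : Equiv.Perm α → Prop)
    (hQ : ∀ π, Q π → ∀ b ∈ K \ F, Q (π * Equiv.swap a b)) :
    (K \ F).card * ((permsOn K).filter fun π : Equiv.Perm α => Q π ∧ π a ∈ B).card ≤
      B.card * ((permsOn K).filter Q).card := by
  calc (K \ F).card * ((permsOn K).filter fun π : Equiv.Perm α => Q π ∧ π a ∈ B).card
      = ∑ b ∈ K \ F, ((permsOn K).filter fun π : Equiv.Perm α => Q π ∧ π a ∈ B).card := by simp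
    _ ≤ ∑ b ∈ K \ F, (((permsOn K).filter Q).filter fun π : Equiv.Perm α => π b ∈ B).card := by
        refine Finset.sum_le_sum fun b hb => ?_
        refine Finset.card_le_card_of_injOn (fun π => π * Equiv.swap a b) ?_ ?_
        · intro π hπ
          simp only [Finset.coe_filter, Set.mem_ofPred_eq, Finset.mem_filter] at hπ ⊢
          refine ⟨⟨permsOn_mul_swap hπ.1 ha (Finset.mem_sdiff.1 hb).1, hQ π hπ.2.1 b hb⟩, ?_⟩
          simpa using hπ.2.2
        · intro π _ σ _ h
          exact mul_right_cancel h
    _ = ∑ π ∈ (permsOn K).filter Q, ((K \ F).filter fun b => π b ∈ B).card := by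
        simp only [Finset.card_filter]
        rw [Finset.sum_comm]
    _ ≤ ∑ π ∈ (permsOn K).filter Q, B.card := by
        refine Finset.sum_le_sum fun π _ => ?_
        refine Finset.card_le_card_of_injOn π ?_ π.injective.injOn
        intro b hb
        simpa using (Finset.mem_filter.1 hb).2
    _ = B.card * ((permsOn K).filter Q).card := by simp [mul_comm]

open Classical in
/-- Given the positions of the points of `F`, the points of a set `I` off `F` are all mapped into
`B` with probability at most `(|B| / L) ^ |I|`. -/
lemma card_permsOn_forall_mem_le {K F B : Finset α} (Q : Equiv.Perm α → Prop)
    (hQ : ∀ π, Q π → ∀ a ∈ K \ F, ∀ b ∈ K \ F, Q (π * Equiv.swap a b)) (L : ℕ)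
    (I : Finset α) (hI : I ⊆ K \ F) (hL : L + F.card + I.card ≤ K.card) :
    L ^ I.card * ((permsOn K).filter fun π : Equiv.Perm α => Q π ∧ ∀ a ∈ I, π a ∈ B).card ≤
      B.card ^ I.card * ((permsOn K).filter Q).card := by
  induction I using Finset.induction_on with
  | empty => simp
  | insert a I haI ih =>
    rw [Finset.card_insert_of_notMem haI] at hL ⊢
    have hI' : I ⊆ K \ F := (Finset.subset_insert a I).trans hI
    have ha : a ∈ K \ F := hI (Finset.mem_insert_self a I)
    have ih := ih hI' (by omega)
    have step := card_permsOn_apply_mem_le (K := K) (F := F ∪ I) (B := B)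
      (Finset.mem_sdiff.1 ha).1 (fun π => Q π ∧ ∀ a ∈ I, π a ∈ B) (by
        rintro π ⟨h1, h2⟩ b hb
        rw [Finset.mem_sdiff, Finset.mem_union, not_or] at hb
        refine ⟨hQ π h1 a ha b (Finset.mem_sdiff.2 ⟨hb.1, hb.2.1⟩), fun c hc => ?_⟩
        rw [Equiv.Perm.mul_apply, Equiv.swap_apply_of_ne_of_ne]
        · exact h2 c hc
        · rintro rfl; exact haI hc
        · rintro rfl; exact hb.2.2 hc)
    have hcard : L ≤ (K \ (F ∪ I)).card := by
      have h1 := Finset.le_card_sdiff (F ∪ I) K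
      have h2 := Finset.card_union_le F I
      omega
    have heq : ((permsOn K).filter fun π : Equiv.Perm α => Q π ∧ ∀ b ∈ insert a I, π b ∈ B) =
        (permsOn K).filter fun π : Equiv.Perm α => (Q π ∧ ∀ a ∈ I, π a ∈ B) ∧ π a ∈ B := by
      ext π
      simp only [Finset.mem_filter, Finset.forall_mem_insert]
      tauto
    rw [heq]
    calc L ^ (I.card + 1) *
          ((permsOn K).filter fun π : Equiv.Perm α => (Q π ∧ ∀ a ∈ I, π a ∈ B) ∧ π a ∈ B).card
        ≤ L ^ I.card * (B.card *
          ((permsOn K).filter fun π : Equiv.Perm α => Q π ∧ ∀ a ∈ I, π a ∈ B).card) := by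
          rw [pow_succ, mul_assoc]
          exact Nat.mul_le_mul_left _ (Nat.le_trans (Nat.mul_le_mul_right _ hcard) (by convert step))
      _ ≤ B.card ^ (I.card + 1) * ((permsOn K).filter Q).card := by
          rw [mul_left_comm, pow_succ', mul_assoc]
          exact Nat.mul_le_mul_left _ ih

open Classical in
/-- If the increasing property `P` of a set is always witnessed by at most `w` of its elements, then
conditioning on `P (π J)` hardly affects the chance that `π` maps many elements of `S` into `B`:
the witnesses account for only `w` of those elements, and there are at most `4 ^ |S|` choices for
the witnesses together with `q` other elements mapped into `B`. -/
lemma card_permsOn_inter_le {K S J B : Finset α} (hJS : J ⊆ S) (hSK : S ⊆ K)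
    (P : Finset α → Prop) (hmono : ∀ X Y, X ⊆ Y → P X → P Y) {w q L : ℕ}
    (hwit : ∀ X ⊆ K, P X → ∃ Y ⊆ X, Y.card ≤ w ∧ P Y) (hL : L + w + q ≤ K.card) :
    L ^ q * ((permsOn K).filter fun π : Equiv.Perm α =>
        P (J.image π) ∧ w + q ≤ (S.image π ∩ B).card).card ≤
      4 ^ S.card * (B.card ^ q *
        ((permsOn K).filter fun π : Equiv.Perm α => P (J.image π)).card) := by
  set pairs := (S.powerset ×ˢ S.powerset).filter fun p =>
    p.1 ⊆ J ∧ p.1.card ≤ w ∧ p.2 ⊆ S \ p.1 ∧ p.2.card = q with hpairs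
  have hsub : ((permsOn K).filter fun π : Equiv.Perm α =>
        P (J.image π) ∧ w + q ≤ (S.image π ∩ B).card) ⊆
      pairs.biUnion fun p => (permsOn K).filter fun π : Equiv.Perm α =>
        P (p.1.image π) ∧ ∀ a ∈ p.2, π a ∈ B := by
    intro π hπ
    obtain ⟨hπ, hP, hm⟩ := Finset.mem_filter.1 hπ
    have hJK : J.image π ⊆ K := by
      intro b hb
      obtain ⟨a, ha, rfl⟩ := Finset.mem_image.1 hb
      exact (apply_mem_iff_of_permsOn hπ a).2 (hSK (hJS ha))
    obtain ⟨Y, hYJ, hYw, hPY⟩ := hwit _ hJK hP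
    obtain ⟨F, hFJ, rfl⟩ := Finset.subset_image_iff.1 hYJ
    replace hFJ : F ⊆ J := by exact_mod_cast hFJ
    rw [Finset.card_image_of_injective _ π.injective] at hYw
    have hq : q ≤ ((S \ F).filter fun a => π a ∈ B).card := by
      have h1 : (S.image π ∩ B).card = (S.filter fun a => π a ∈ B).card := by
        rw [← Finset.card_image_of_injective (S.filter fun a => π a ∈ B) π.injective]
        congr 1
        ext b
        simp only [Finset.mem_inter, Finset.mem_image, Finset.mem_filter]
        constructor
        · rintro ⟨⟨a, ha, rfl⟩, hb⟩; exact ⟨a, ⟨ha, hb⟩, rfl⟩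
        · rintro ⟨a, ⟨ha, hb⟩, rfl⟩; exact ⟨⟨a, ha, rfl⟩, hb⟩
      have h2 : (S.filter fun a => π a ∈ B) ⊆ ((S \ F).filter fun a => π a ∈ B) ∪ F := by
        intro a ha
        simp only [Finset.mem_union, Finset.mem_filter, Finset.mem_sdiff] at ha ⊢
        tauto
      have h3 := (Finset.card_le_card h2).trans (Finset.card_union_le _ _)
      omega
    obtain ⟨I, hI, hIq⟩ := Finset.exists_subset_card_eq hq
    have hIS : I ⊆ S \ F := hI.trans (Finset.filter_subset _ _)
    refine Finset.mem_biUnion.2 ⟨(F, I), ?_, ?_⟩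
    · simp only [hpairs, Finset.mem_filter, Finset.mem_product, Finset.mem_powerset]
      exact ⟨⟨hFJ.trans hJS, hIS.trans Finset.sdiff_subset⟩, hFJ, hYw, hIS, hIq⟩
    · exact Finset.mem_filter.2 ⟨hπ, hPY, fun a ha => (Finset.mem_filter.1 (hI ha)).2⟩
  have hpair : ∀ p ∈ pairs, L ^ q * ((permsOn K).filter fun π : Equiv.Perm α =>
      P (p.1.image π) ∧ ∀ a ∈ p.2, π a ∈ B).card ≤
        B.card ^ q * ((permsOn K).filter fun π : Equiv.Perm α => P (J.image π)).card := by
    rintro ⟨F, I⟩ hp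
    simp only [hpairs, Finset.mem_filter, Finset.mem_product, Finset.mem_powerset] at hp
    obtain ⟨-, hFJ, hFw, hI, rfl⟩ := hp
    refine (card_permsOn_forall_mem_le (K := K) (F := F) (B := B) (fun π => P (F.image π)) ?_ L I
      (hI.trans (Finset.sdiff_subset_sdiff hSK le_rfl)) (by omega)).trans ?_
    · intro π h a ha b hb
      have : F.image (π * Equiv.swap a b) = F.image π := by
        refine Finset.image_congr fun c hc => ?_
        rw [Equiv.Perm.mul_apply, Equiv.swap_apply_of_ne_of_ne]
        · rintro rfl; exact (Finset.mem_sdiff.1 ha).2 hc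
        · rintro rfl; exact (Finset.mem_sdiff.1 hb).2 hc
      rwa [this]
    · refine Nat.mul_le_mul_left _ (Finset.card_le_card ?_)
      exact Finset.monotone_filter_right _ fun π _ => hmono _ _ (Finset.image_subset_image hFJ)
  have hcard : pairs.card ≤ 4 ^ S.card := by
    refine (Finset.card_filter_le _ _).trans ?_
    rw [Finset.card_product, Finset.card_powerset, ← mul_pow]
    norm_num
  calc _ ≤ L ^ q * ∑ p ∈ pairs, ((permsOn K).filter fun π : Equiv.Perm α =>
      P (p.1.image π) ∧ ∀ a ∈ p.2, π a ∈ B).card := by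
        gcongr
        exact (Finset.card_le_card hsub).trans Finset.card_biUnion_le
    _ ≤ ∑ p ∈ pairs, B.card ^ q *
          ((permsOn K).filter fun π : Equiv.Perm α => P (J.image π)).card := by
        rw [Finset.mul_sum]
        exact Finset.sum_le_sum hpair
    _ ≤ _ := by
        rw [Finset.sum_const, smul_eq_mul]
        gcongr

end Permutations

/-! ### Star edges and the swap inequality -/

section Star

variable {n : ℕ}

/-- The `r`-sets that meet `Z` in the vertex `x` only. -/
def starEdges (r : ℕ) (Z : Finset (Fin n)) (x : Fin n) : Hyp n :=
  (edgesOn r Finset.univ).filter fun A => A ∩ Z = {x}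

lemma mem_edgesOn {r : ℕ} {W A : Finset (Fin n)} : A ∈ edgesOn r W ↔ A ⊆ W ∧ A.card = r := by
  simp [edgesOn, Finset.mem_powersetCard]

lemma mem_starEdges {r : ℕ} {Z A : Finset (Fin n)} {x : Fin n} :
    A ∈ starEdges r Z x ↔ A.card = r ∧ A ∩ Z = {x} := by
  simp [starEdges, mem_edgesOn]

lemma mem_of_mem_starEdges {r : ℕ} {Z A : Finset (Fin n)} {x : Fin n}
    (hA : A ∈ starEdges r Z x) : x ∈ A :=
  (Finset.mem_inter.1 ((mem_starEdges.1 hA).2 ▸ Finset.mem_singleton_self x)).1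

lemma not_disjoint_of_mem_starEdges {r : ℕ} {Z A : Finset (Fin n)} {x : Fin n}
    (hA : A ∈ starEdges r Z x) : ¬ Disjoint A Z := by
  rw [Finset.disjoint_iff_inter_eq_empty, (mem_starEdges.1 hA).2]
  exact Finset.singleton_ne_empty x

lemma eq_of_mem_starEdges {r : ℕ} {Z A : Finset (Fin n)} {x z : Fin n}
    (hA : A ∈ starEdges r Z x) (hz : z ∈ A) (hzZ : z ∈ Z) : z = x := by
  have : z ∈ A ∩ Z := Finset.mem_inter.2 ⟨hz, hzZ⟩
  rwa [(mem_starEdges.1 hA).2, Finset.mem_singleton] at this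

lemma erase_subset_of_mem_starEdges {r : ℕ} {Z A : Finset (Fin n)} {x : Fin n}
    (hA : A ∈ starEdges r Z x) : A.erase x ⊆ Finset.univ \ Z := by
  intro v hv
  rw [Finset.mem_erase] at hv
  rw [Finset.mem_sdiff]
  exact ⟨Finset.mem_univ _, fun h => hv.1 (eq_of_mem_starEdges hA hv.2 h)⟩

lemma insert_erase_mem_edgesOn {r : ℕ} {Z A : Finset (Fin n)} {x y : Fin n}
    (hA : A ∈ starEdges r Z x) (hy : y ∉ Z) (hyA : y ∉ A) :
    insert y (A.erase x) ∈ edgesOn r (Finset.univ \ Z) := by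
  rw [mem_edgesOn]
  constructor
  · exact Finset.insert_subset (by simpa using hy) (erase_subset_of_mem_starEdges hA)
  · rw [Finset.card_insert_of_notMem (fun h => hyA (Finset.mem_of_mem_erase h)),
      Finset.card_erase_add_one (mem_of_mem_starEdges hA), (mem_starEdges.1 hA).1]

lemma card_starEdges {r : ℕ} (hr : 1 ≤ r) {Z : Finset (Fin n)} {x : Fin n} (hx : x ∈ Z) :
    (starEdges r Z x).card = (Finset.univ \ Z).card.choose (r - 1) := by
  rw [← Finset.card_powersetCard]
  have h : starEdges r Z x = ((Finset.univ \ Z).powersetCard (r - 1)).image (insert x) := by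
    ext A
    simp only [Finset.mem_image, Finset.mem_powersetCard]
    constructor
    · intro hA
      refine ⟨A.erase x, ⟨erase_subset_of_mem_starEdges hA, ?_⟩,
        Finset.insert_erase (mem_of_mem_starEdges hA)⟩
      rw [Finset.card_erase_of_mem (mem_of_mem_starEdges hA), (mem_starEdges.1 hA).1]
    · rintro ⟨U, ⟨hU, hUc⟩, rfl⟩
      have hd : Disjoint U Z := Finset.disjoint_left.2 fun v hv => (Finset.mem_sdiff.1 (hU hv)).2
      have hxU : x ∉ U := fun h => Finset.disjoint_left.1 hd h hx
      rw [mem_starEdges, Finset.card_insert_of_notMem hxU, Finset.insert_inter_of_mem hx,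
        Finset.disjoint_iff_inter_eq_empty.1 hd]
      exact ⟨by omega, rfl⟩
  rw [h, Finset.card_image_of_injOn]
  intro U hU U' hU' hUU'
  have hxU : ∀ U ∈ (Finset.univ \ Z).powersetCard (r - 1), x ∉ U := fun U hU h =>
    (Finset.mem_sdiff.1 ((Finset.mem_powersetCard.1 hU).1 h)).2 hx
  rw [← Finset.erase_insert (hxU U hU), ← Finset.erase_insert (hxU U' hU'), hUU']

lemma deg_le_card_inter_starEdges_add {r : ℕ} {h : Hyp n} (hh : h ⊆ edgesOn r Finset.univ)
    {Z : Finset (Fin n)} {x : Fin n} (hx : x ∈ Z) :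
    deg h x ≤ (h ∩ starEdges r Z x).card + ∑ z ∈ Z.erase x, codeg h x z := by
  have hsub : (h.filter fun A => x ∈ A) ⊆ (h ∩ starEdges r Z x) ∪
      (Z.erase x).biUnion fun z => h.filter fun A => x ∈ A ∧ z ∈ A := by
    intro A hA
    obtain ⟨hA, hxA⟩ := Finset.mem_filter.1 hA
    by_cases hAZ : A ∩ Z = {x}
    · exact Finset.mem_union_left _
        (Finset.mem_inter.2 ⟨hA, mem_starEdges.2 ⟨(mem_edgesOn.1 (hh hA)).2, hAZ⟩⟩)
    · obtain ⟨z, hz, hzx⟩ : ∃ z ∈ A ∩ Z, z ≠ x := by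
        by_contra! hcon
        exact hAZ (Finset.eq_singleton_iff_unique_mem.2 ⟨Finset.mem_inter.2 ⟨hxA, hx⟩, hcon⟩)
      rw [Finset.mem_inter] at hz
      exact Finset.mem_union_right _ (Finset.mem_biUnion.2
        ⟨z, Finset.mem_erase.2 ⟨hzx, hz.2⟩, Finset.mem_filter.2 ⟨hA, hxA, hz.1⟩⟩)
  refine (Finset.card_le_card hsub).trans ((Finset.card_union_le _ _).trans ?_)
  exact Nat.add_le_add_left Finset.card_biUnion_le _

/-- A perfect matching of `h` off `(Z \ {x}) ∪ {y}` is obtained from a star edge `A` and a perfect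
matching of `h - Z` off `(A \ {x}) ∪ {y}`. -/
lemma sum_weight_le_weight {r : ℕ} {h : Hyp n}
    {Z : Finset (Fin n)} (hZ : Z.card = r) {x y : Fin n} (hx : x ∈ Z) (hy : y ∉ Z) :
    ∑ A ∈ (h ∩ starEdges r Z x).filter (fun A => y ∉ A),
        weight r (Finset.univ \ Z) (remove h Z) (insert y (A.erase x)) ≤
      weight r Finset.univ h (insert y (Z.erase x)) := by
  simp only [weight, numPM]
  rw [← Finset.card_sigma]
  -- The edges of the smaller matching avoid `Z` and `A`.
  have key : ∀ A μ, A ∈ starEdges r Z x →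
      μ ⊆ remove (remove h Z) (insert y (A.erase x)) → ∀ B ∈ μ,
      B ∈ h ∧ Disjoint B Z ∧ y ∉ B ∧ Disjoint A B := by
    intro A μ hA hμ B hB
    have hB' := hμ hB
    simp only [remove, Finset.mem_filter, Finset.disjoint_insert_right] at hB'
    obtain ⟨⟨hBh, hBZ⟩, hyB, hBA⟩ := hB'
    refine ⟨hBh, hBZ, hyB, ?_⟩
    rw [← Finset.insert_erase (mem_of_mem_starEdges hA), Finset.disjoint_insert_left]
    exact ⟨fun hxB => Finset.disjoint_left.1 hBZ hxB hx, hBA.symm⟩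
  refine Finset.card_le_card_of_injOn (fun p => insert p.1 p.2) ?_ ?_
  · rintro ⟨A, μ⟩ hp
    simp only [Finset.coe_sigma, Set.mem_sigma_iff, Finset.mem_coe, Finset.mem_filter,
      Finset.mem_inter, perfectMatchings, Finset.mem_powerset] at hp ⊢
    obtain ⟨⟨⟨hAh, hA⟩, hyA⟩, hμ, hdis, hcard⟩ := hp
    have key := key A μ hA hμ
    have hAμ : A ∉ μ := fun hmem =>
      Finset.disjoint_left.1 (key A hmem).2.2.2 (mem_of_mem_starEdges hA) (mem_of_mem_starEdges hA)
    refine ⟨?_, ?_, ?_⟩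
    · rw [Finset.insert_subset_iff]
      constructor
      · simp only [remove, Finset.mem_filter, Finset.disjoint_insert_right]
        refine ⟨hAh, hyA, Finset.disjoint_left.2 fun v hv hvZ => ?_⟩
        rw [Finset.mem_erase] at hvZ
        exact hvZ.1 (eq_of_mem_starEdges hA hv hvZ.2)
      · intro B hB
        obtain ⟨h1, h2, h3, -⟩ := key B hB
        simp only [remove, Finset.mem_filter, Finset.disjoint_insert_right]
        exact ⟨h1, h3, h2.mono_right (Finset.erase_subset _ _)⟩
    · intro B hB B' hB' hne
      rw [Finset.mem_insert] at hB hB'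
      rcases hB with rfl | hB <;> rcases hB' with rfl | hB'
      · exact absurd rfl hne
      · exact (key B' hB').2.2.2
      · exact (key B hB).2.2.2.symm
      · exact hdis B hB B' hB' hne
    · have hP := mem_edgesOn.1 (insert_erase_mem_edgesOn hA hy hyA)
      have h1 := Finset.card_sdiff_add_card_eq_card hP.1
      have h2 := Finset.card_sdiff_add_card_eq_card (Finset.subset_univ Z)
      have h3 := Finset.card_sdiff_add_card_eq_card (Finset.subset_univ (insert y (Z.erase x)))
      have h4 : (insert y (Z.erase x)).card = r := by
        rw [Finset.card_insert_of_notMem (fun h => hy (Finset.mem_of_mem_erase h)),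
          Finset.card_erase_add_one hx, hZ]
      rw [Finset.card_insert_of_notMem hAμ, add_mul, one_mul]
      omega
  · rintro ⟨A, μ⟩ hp ⟨A', μ'⟩ hp' heq
    simp only [Finset.coe_sigma, Set.mem_sigma_iff, Finset.mem_coe, Finset.mem_filter,
      Finset.mem_inter, perfectMatchings, Finset.mem_powerset] at hp hp' heq
    have hk := key A μ hp.1.1.2 hp.2.1
    have hk' := key A' μ' hp'.1.1.2 hp'.2.1
    have hxA := mem_of_mem_starEdges hp.1.1.2
    have hxA' := mem_of_mem_starEdges hp'.1.1.2
    have hnot : ∀ B ∈ μ', x ∉ B := fun B hB hxB =>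
      Finset.disjoint_left.1 (hk' B hB).2.1 hxB hx
    have hnot' : ∀ B ∈ μ, x ∉ B := fun B hB hxB =>
      Finset.disjoint_left.1 (hk B hB).2.1 hxB hx
    have hAA : A = A' := by
      have : A ∈ insert A' μ' := heq ▸ Finset.mem_insert_self A μ
      rcases Finset.mem_insert.1 this with h | h
      · exact h
      · exact absurd hxA (hnot A h)
    subst hAA
    have : μ = μ' := by
      rw [← Finset.erase_insert (fun h => hnot' A h hxA),
        ← Finset.erase_insert (fun h => hnot A h hxA), heq]
    rw [this]

open Classical in
/-- The star edges `A` for which `(A \ {x}) ∪ {y}` is not an `r`-set of about the average weight in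
the `r`-graph `g` on `V \ Z`. -/
noncomputable def badStar (θ : ℝ) (r : ℕ) (Z : Finset (Fin n)) (x : Fin n) (g : Hyp n)
    (y : Fin n) : Hyp n :=
  (starEdges r Z x).filter fun A => y ∈ A ∨
    ¬ Approx θ (weight r (Finset.univ \ Z) g (insert y (A.erase x)))
      ((numPM r (Finset.univ \ Z) g : ℝ) / avgDeg r (Finset.univ \ Z) g)

lemma sum_card_badStar_le {θ : ℝ} {r : ℕ} (hr : 1 ≤ r) {Z : Finset (Fin n)} {x : Fin n}
    (hx : x ∈ Z) {g : Hyp n} (hF : PropF θ r (Finset.univ \ Z) g) :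
    ∑ y ∈ Finset.univ \ Z, ((badStar θ r Z x g y).card : ℝ) ≤
      (r + |θ| * (Finset.univ \ Z).card) * (starEdges r Z x).card := by
  classical
  set W := Finset.univ \ Z with hW
  set K := starEdges r Z x with hK
  set N := W.card with hN
  set ok : Finset (Fin n) → Prop := fun U =>
    Approx θ (weight r W g U) ((numPM r W g : ℝ) / avgDeg r W g) with hok
  set bad := (edgesOn r W).filter fun U => ¬ ok U with hbad
  have hF' : (bad.card : ℝ) ≤ θ * (edgesOn r W).card := by
    have := hF
    unfold PropF AlmostAll at this
    convert this
  -- Star edges through `y`, and star edges extending to a bad `r`-set.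
  have hsplit : ∀ y ∈ W, (badStar θ r Z x g y).card ≤ (K.filter fun A => y ∈ A).card +
      (K.filter fun A => y ∉ A ∧ ¬ ok (insert y (A.erase x))).card := by
    intro y _
    refine (Finset.card_le_card ?_).trans (Finset.card_union_le _ _)
    intro A hA
    obtain ⟨hA, h⟩ := Finset.mem_filter.1 hA
    simp only [Finset.mem_union, Finset.mem_filter]
    by_cases hyA : y ∈ A
    · exact Or.inl ⟨hA, hyA⟩
    · exact Or.inr ⟨hA, hyA, h.resolve_left hyA⟩
  have h1 : ∑ y ∈ W, (K.filter fun A => y ∈ A).card ≤ r * K.card := by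
    simp only [Finset.card_filter]
    rw [Finset.sum_comm]
    simp only [← Finset.card_filter]
    calc ∑ A ∈ K, (W.filter fun y => y ∈ A).card ≤ ∑ A ∈ K, r := by
          refine Finset.sum_le_sum fun A hA => ?_
          rw [← (mem_starEdges.1 hA).1]
          exact Finset.card_le_card fun y hy => (Finset.mem_filter.1 hy).2
      _ = r * K.card := by simp [mul_comm]
  have h2 : ∑ y ∈ W, (K.filter fun A => y ∉ A ∧ ¬ ok (insert y (A.erase x))).card ≤
      bad.card * r := by
    have h3 : ∑ U ∈ bad, U.card = bad.card * r := by
      rw [Finset.sum_congr rfl (g := fun _ => r), Finset.sum_const, smul_eq_mul]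
      intro U hU
      exact (mem_edgesOn.1 (Finset.mem_filter.1 hU).1).2
    rw [← h3, ← Finset.card_sigma, ← Finset.card_sigma]
    refine Finset.card_le_card_of_injOn (fun p => ⟨insert p.1 (p.2.erase x), p.1⟩) ?_ ?_
    · rintro ⟨y, A⟩ hp
      simp only [Finset.coe_sigma, Set.mem_sigma_iff, Finset.mem_coe, Finset.mem_filter,
        hbad] at hp ⊢
      obtain ⟨hy, hA, hyA, hnok⟩ := hp
      exact ⟨⟨insert_erase_mem_edgesOn hA (Finset.mem_sdiff.1 hy).2 hyA, hnok⟩,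
        Finset.mem_insert_self _ _⟩
    · rintro ⟨y, A⟩ hp ⟨y', A'⟩ hp' heq
      simp only [Finset.coe_sigma, Set.mem_sigma_iff, Finset.mem_coe, Finset.mem_filter] at hp hp'
      simp only [Sigma.mk.injEq, heq_eq_eq] at heq
      obtain ⟨heq, rfl⟩ := heq
      have e : A.erase x = A'.erase x := by
        rw [← Finset.erase_insert (fun h => hp.2.2.1 (Finset.mem_of_mem_erase h)), heq,
          Finset.erase_insert (fun h => hp'.2.2.1 (Finset.mem_of_mem_erase h))]
      have : A = A' := by
        rw [← Finset.insert_erase (mem_of_mem_starEdges hp.2.1), e,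
          Finset.insert_erase (mem_of_mem_starEdges hp'.2.1)]
      rw [this]
  have h3 : (edgesOn r W).card * r ≤ N * K.card := by
    rw [hK, card_starEdges hr hx, edgesOn, Finset.card_powersetCard]
    obtain ⟨m, rfl⟩ : ∃ m, r = m + 1 := ⟨r - 1, by omega⟩
    rw [Nat.choose_succ_right_eq, Nat.add_sub_cancel, mul_comm]
    exact Nat.mul_le_mul_right _ (Nat.sub_le _ _)
  have h4 : ∑ y ∈ W, (badStar θ r Z x g y).card ≤ r * K.card + bad.card * r :=
    (Finset.sum_le_sum hsplit).trans (by
      rw [Finset.sum_add_distrib]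
      exact Nat.add_le_add h1 h2)
  have h3' : ((edgesOn r W).card : ℝ) * r ≤ N * K.card := by exact_mod_cast h3
  have h4' : ∑ y ∈ W, ((badStar θ r Z x g y).card : ℝ) ≤ r * K.card + bad.card * r := by
    exact_mod_cast h4
  calc ∑ y ∈ W, ((badStar θ r Z x g y).card : ℝ) ≤ r * K.card + bad.card * r := h4'
    _ ≤ r * K.card + (|θ| * (edgesOn r W).card) * r := by
        gcongr
        exact hF'.trans (by gcongr; exact le_abs_self θ)
    _ = r * K.card + |θ| * ((edgesOn r W).card * r) := by ring
    _ ≤ r * K.card + |θ| * (N * K.card) := by gcongr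
    _ = _ := by ring

/-- By Markov's inequality, few vertices `y` have more than a `γ`-fraction of bad star edges. -/
lemma almostAll_card_badStar_le {θ γ : ℝ} {r : ℕ} (hr : 1 ≤ r) {Z : Finset (Fin n)} {x : Fin n}
    (hx : x ∈ Z) {g : Hyp n} (hF : PropF θ r (Finset.univ \ Z) g) (hγ : 0 < γ)
    (hγθ : r + |θ| * (Finset.univ \ Z).card ≤ γ ^ 2 * (Finset.univ \ Z).card)
    (hK : 0 < (starEdges r Z x).card) :
    AlmostAll γ (Finset.univ \ Z) fun y =>
      ((badStar θ r Z x g y).card : ℝ) ≤ γ * (starEdges r Z x).card := by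
  classical
  unfold AlmostAll
  set W := Finset.univ \ Z
  set K := starEdges r Z x
  set X := W.filter fun y => ¬ ((badStar θ r Z x g y).card : ℝ) ≤ γ * K.card with hX
  have hK' : (0 : ℝ) < K.card := by exact_mod_cast hK
  have h1 : (X.card : ℝ) * (γ * K.card) ≤ γ * W.card * (γ * K.card) := by
    calc (X.card : ℝ) * (γ * K.card) = ∑ y ∈ X, γ * K.card := by simp
      _ ≤ ∑ y ∈ X, ((badStar θ r Z x g y).card : ℝ) :=
          Finset.sum_le_sum fun y hy => (not_le.1 (Finset.mem_filter.1 hy).2).le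
      _ ≤ ∑ y ∈ W, ((badStar θ r Z x g y).card : ℝ) :=
          Finset.sum_le_sum_of_subset_of_nonneg (Finset.filter_subset _ _) fun _ _ _ => by positivity
      _ ≤ (r + |θ| * W.card) * K.card := sum_card_badStar_le hr hx hF
      _ ≤ (γ ^ 2 * W.card) * K.card := by gcongr
      _ = _ := by ring
  have h2 := le_of_mul_le_mul_right h1 (by positivity)
  convert h2

lemma numPM_empty {r : ℕ} {W : Finset (Fin n)} (hW : 0 < W.card) : numPM r W ∅ = 0 := by
  rw [numPM, Finset.card_eq_zero, Finset.eq_empty_iff_forall_notMem]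
  intro μ hμ
  simp only [perfectMatchings, Finset.mem_filter, Finset.mem_powerset, Finset.subset_empty] at hμ
  obtain ⟨rfl, -, h⟩ := hμ
  simp at h
  omega

/-- All but an `r |θ| / (c ε)`-fraction of the edges at `x` are star edges. -/
lemma mul_deg_le_card_inter_starEdges {r : ℕ} {ε θ C c : ℝ} (hε : 0 < ε) (hc : 0 < c) {h : Hyp n}
    (hh : h ⊆ edgesOn r Finset.univ) (hR : PropR0 r ε θ C c h) {Z : Finset (Fin n)}
    (hZ : Z.card = r) {x : Fin n} (hx : x ∈ Z) :
    (1 - r * |θ| / (c * ε)) * deg h x ≤ ((h ∩ starEdges r Z x).card : ℝ) := by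
  have h1 : (deg h x : ℝ) ≤ (h ∩ starEdges r Z x).card + ∑ z ∈ Z.erase x, (codeg h x z : ℝ) := by
    exact_mod_cast deg_le_card_inter_starEdges_add hh hx
  have hD : 0 ≤ avgDeg r Finset.univ h := by unfold avgDeg; positivity
  have h2 : ∑ z ∈ Z.erase x, (codeg h x z : ℝ) ≤ r * (|θ| * avgDeg r Finset.univ h) := by
    calc ∑ z ∈ Z.erase x, (codeg h x z : ℝ)
        ≤ ∑ z ∈ Z.erase x, |θ| * avgDeg r Finset.univ h := by
          refine Finset.sum_le_sum fun z hz => ?_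
          refine (hR.max_codeg x z (Finset.ne_of_mem_erase hz).symm).trans ?_
          gcongr
          exact le_abs_self θ
      _ = (Z.erase x).card * (|θ| * avgDeg r Finset.univ h) := by simp
      _ ≤ r * (|θ| * avgDeg r Finset.univ h) := by
          gcongr
          rw [← hZ]
          exact Finset.card_le_card (Finset.erase_subset _ _)
  have h3 : avgDeg r Finset.univ h ≤ deg h x / (c * ε) := by
    rw [le_div_iff₀ (by positivity), mul_comm]
    exact hR.min_deg x
  have h4 : r * (|θ| * avgDeg r Finset.univ h) ≤ r * (|θ| * (deg h x / (c * ε))) := by gcongr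
  have h5 : r * (|θ| * (deg h x / (c * ε))) = r * |θ| / (c * ε) * deg h x := by ring
  linarith

lemma one_sub_sum_le_prod {a b c d : ℝ} (ha : 0 ≤ a) (hb : 0 ≤ b) (hc : 0 ≤ c) (hd : 0 ≤ d)
    (ha1 : a ≤ 1) (hb1 : b ≤ 1) (hc1 : c ≤ 1) :
    1 - (a + b + c + d) ≤ (1 - a) * (1 - b) * (1 - c) * (1 - d) := by
  have h1 : 1 - (a + b) ≤ (1 - a) * (1 - b) := by nlinarith [mul_nonneg ha hb]
  have h0 : 0 ≤ (1 - a) * (1 - b) := mul_nonneg (by linarith) (by linarith)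
  have h01 : (1 - a) * (1 - b) ≤ 1 := mul_le_one₀ (by linarith) (by linarith) (by linarith)
  have h2 : 1 - (a + b + c) ≤ (1 - a) * (1 - b) * (1 - c) := by nlinarith
  have h02 : (1 - a) * (1 - b) * (1 - c) ≤ 1 := mul_le_one₀ h01 (by linarith) (by linarith)
  nlinarith

/-- The swap inequality at `y` holds as soon as few of the star edges of `h` are bad for `y`. -/
lemma swap_le_weight {r : ℕ} {ε θ C c γ' θ' : ℝ} (hε : 0 < ε) (hc : 0 < c)
    {h : Hyp n} (hh : h ⊆ edgesOn r Finset.univ) (hR : PropR0 r ε θ C c h) {Z : Finset (Fin n)}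
    (hZ : Z.card = r) {x y : Fin n} (hx : x ∈ Z) (hy : y ∉ Z) (hrn : r < n)
    (hγ' : 0 ≤ γ') (hγ'1 : γ' ≤ 1) (hθ : |θ| ≤ 1) (hθr : r * |θ| / (c * ε) ≤ 1)
    (hθ' : γ' + |θ| + r * |θ| / (c * ε) + r / n ≤ θ')
    (hbad : ((h ∩ badStar θ r Z x (remove h Z) y).card : ℝ) ≤
      γ' * (h ∩ starEdges r Z x).card) :
    (1 - θ') * ((weight r Finset.univ h Z : ℝ) * deg h x / avgDeg r Finset.univ h) ≤
      (weight r Finset.univ h (insert y (Z.erase x)) : ℝ) := by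
  classical
  set W := Finset.univ \ Z with hW
  set g := remove h Z with hg
  have hΦ : weight r Finset.univ h Z = numPM r W g := rfl
  rw [hΦ]
  set Φ := numPM r W g with hΦ'
  set D := avgDeg r Finset.univ h with hD
  set D' := avgDeg r W g with hD'
  set S := h ∩ starEdges r Z x with hS
  have hr : 0 < r := hZ ▸ Finset.card_pos.2 ⟨x, hx⟩
  have hWc : W.card = n - r := by
    rw [hW, Finset.card_sdiff_of_subset (Finset.subset_univ Z), hZ, Finset.card_univ,
      Fintype.card_fin]
  have hnr : (0 : ℝ) < n - r := by
    have : (r : ℝ) < n := by exact_mod_cast hrn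
    linarith
  have hWc' : (W.card : ℝ) = n - r := by rw [hWc, Nat.cast_sub hrn.le]
  rcases Nat.eq_zero_or_pos Φ with h0 | hΦpos
  · rw [h0]; simp
  have hΦR : (0 : ℝ) < Φ := by exact_mod_cast hΦpos
  have hgpos : 0 < g.card := by
    rw [Finset.card_pos, Finset.nonempty_iff_ne_empty]
    intro hge
    rw [hΦ', hge, numPM_empty (by omega)] at hΦpos
    exact lt_irrefl _ hΦpos
  have hgh : g.card ≤ h.card := Finset.card_le_card (Finset.filter_subset _ _)
  have hgposR : (0 : ℝ) < g.card := by exact_mod_cast hgpos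
  have hhposR : (0 : ℝ) < h.card := by exact_mod_cast hgpos.trans_le hgh
  have hrR : (0 : ℝ) < r := by exact_mod_cast hr
  have hnR : (0 : ℝ) < n := by linarith
  have hDe : D = r * h.card / n := by simp [hD, avgDeg]
  have hD'e : D' = r * g.card / (n - r) := by rw [hD', avgDeg, hWc']
  have hDpos : 0 < D := by rw [hDe]; positivity
  have hD'pos : 0 < D' := by rw [hD'e]; positivity
  have hDD' : (1 - r / n) * D' ≤ D := by
    rw [hDe, hD'e]
    have : (1 - (r : ℝ) / n) * (r * g.card / (n - r)) = r * g.card / n := by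
      field_simp
    rw [this]
    gcongr
  have hΦD : (1 - r / n) * (Φ / D) ≤ Φ / D' := by
    rw [le_div_iff₀ hD'pos]
    calc (1 - r / n) * (Φ / D) * D' = (1 - r / n) * D' * (Φ / D) := by ring
      _ ≤ D * (Φ / D) := by gcongr
      _ = Φ := by field_simp
  have hdeg := mul_deg_le_card_inter_starEdges hε hc hh hR hZ hx
  -- The star edges that are not bad for `y` all contribute about the average weight.
  have hsum : ((S \ badStar θ r Z x g y).card : ℝ) * ((1 - |θ|) * (Φ / D')) ≤
      (weight r Finset.univ h (insert y (Z.erase x)) : ℝ) := by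
    have h1 : ((∑ A ∈ S.filter (fun A => y ∉ A), weight r W g (insert y (A.erase x)) : ℕ) : ℝ) ≤
        weight r Finset.univ h (insert y (Z.erase x)) := by
      exact_mod_cast sum_weight_le_weight hZ hx hy
    refine le_trans ?_ h1
    push_cast
    calc ((S \ badStar θ r Z x g y).card : ℝ) * ((1 - |θ|) * (Φ / D'))
        = ∑ A ∈ S \ badStar θ r Z x g y, (1 - |θ|) * (Φ / D') := by simp
      _ ≤ ∑ A ∈ S \ badStar θ r Z x g y, (weight r W g (insert y (A.erase x)) : ℝ) := by
          refine Finset.sum_le_sum fun A hA => ?_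
          obtain ⟨hAS, hAb⟩ := Finset.mem_sdiff.1 hA
          have hAK := (Finset.mem_inter.1 hAS).2
          have hok : Approx θ (weight r W g (insert y (A.erase x))) (Φ / D') := by
            by_contra hcon
            exact hAb (Finset.mem_filter.2 ⟨hAK, Or.inr hcon⟩)
          have := (abs_le.1 hok).1
          have h2 : θ * (Φ / D') ≤ |θ| * (Φ / D') := by gcongr; exact le_abs_self θ
          linarith
      _ ≤ ∑ A ∈ S.filter (fun A => y ∉ A), (weight r W g (insert y (A.erase x)) : ℝ) := by
          refine Finset.sum_le_sum_of_subset_of_nonneg ?_ fun _ _ _ => by positivity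
          intro A hA
          obtain ⟨hAS, hAb⟩ := Finset.mem_sdiff.1 hA
          refine Finset.mem_filter.2 ⟨hAS, fun hyA => hAb ?_⟩
          exact Finset.mem_filter.2 ⟨(Finset.mem_inter.1 hAS).2, Or.inl hyA⟩
  have hgood : (1 - γ') * S.card ≤ ((S \ badStar θ r Z x g y).card : ℝ) := by
    have h1 : S.card ≤ (S \ badStar θ r Z x g y).card +
        (h ∩ badStar θ r Z x g y).card := by
      rw [← Finset.card_sdiff_add_card_inter S (badStar θ r Z x g y)]
      gcongr
      exact Finset.inter_subset_left
    have h2 : (S.card : ℝ) ≤ (S \ badStar θ r Z x g y).card +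
        (h ∩ badStar θ r Z x g y).card := by exact_mod_cast h1
    linarith
  have hrn1 : (r : ℝ) / n ≤ 1 := by
    rw [div_le_one hnR]; linarith
  have hprod := one_sub_sum_le_prod hγ' (abs_nonneg θ)
    (show 0 ≤ r * |θ| / (c * ε) by positivity) (show 0 ≤ (r : ℝ) / n by positivity)
    hγ'1 hθ hθr
  have a1 : 0 ≤ 1 - γ' := by linarith
  have a2 : 0 ≤ 1 - |θ| := by linarith
  have a4 : 0 ≤ 1 - (r : ℝ) / n := by linarith
  calc (1 - θ') * (Φ * deg h x / D)
      ≤ ((1 - γ') * (1 - |θ|) * (1 - r * |θ| / (c * ε)) * (1 - r / n)) * (Φ * deg h x / D) := by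
        gcongr
        linarith
    _ = (1 - γ') * ((1 - r * |θ| / (c * ε)) * deg h x) *
          ((1 - |θ|) * ((1 - r / n) * (Φ / D))) := by ring
    _ ≤ (1 - γ') * S.card * ((1 - |θ|) * (Φ / D')) := by gcongr
    _ ≤ (S \ badStar θ r Z x g y).card * ((1 - |θ|) * (Φ / D')) := by gcongr
    _ ≤ _ := hsum

end Star

/-! ### Permuting the star edges in the process -/

section Orbits

variable {n : ℕ}

lemma deg_mono {h h' : Hyp n} (hh : h ⊆ h') (v : Fin n) : deg h v ≤ deg h' v :=
  Finset.card_le_card (Finset.filter_subset_filter _ hh)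

lemma deg_sdiff_add_deg_inter (h K : Hyp n) (v : Fin n) :
    deg (h \ K) v + deg (h ∩ K) v = deg h v := by
  unfold deg
  rw [← Finset.card_union_of_disjoint, ← Finset.filter_union, Finset.sdiff_union_inter]
  exact Finset.disjoint_filter_filter (Finset.disjoint_sdiff_inter h K)

lemma mem_image_of_permsOn {K : Hyp n} {π : Equiv.Perm (Finset (Fin n))} (hπ : π ∈ permsOn K)
    (h : Hyp n) {A : Finset (Fin n)} (hA : A ∉ K) : A ∈ h.image π ↔ A ∈ h := by
  nth_rewrite 1 [← mem_permsOn.1 hπ A hA]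
  rw [π.injective.mem_finset_image]

lemma image_sdiff_of_permsOn {K : Hyp n} {π : Equiv.Perm (Finset (Fin n))} (hπ : π ∈ permsOn K)
    (h : Hyp n) : h.image π \ K = h \ K := by
  ext A
  rw [Finset.mem_sdiff, Finset.mem_sdiff]
  exact and_congr_left fun hA => mem_image_of_permsOn hπ h hA

lemma image_inter_of_permsOn {K : Hyp n} {π : Equiv.Perm (Finset (Fin n))} (hπ : π ∈ permsOn K)
    (h : Hyp n) : h.image π ∩ K = (h ∩ K).image π := by
  ext A
  simp only [Finset.mem_inter, Finset.mem_image]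
  constructor
  · rintro ⟨⟨B, hB, rfl⟩, hK⟩
    exact ⟨B, ⟨hB, (apply_mem_iff_of_permsOn hπ B).1 hK⟩, rfl⟩
  · rintro ⟨B, ⟨hB, hK⟩, rfl⟩
    exact ⟨⟨B, hB, rfl⟩, (apply_mem_iff_of_permsOn hπ B).2 hK⟩

lemma image_eq_of_permsOn {K : Hyp n} {π : Equiv.Perm (Finset (Fin n))} (hπ : π ∈ permsOn K)
    {h : Hyp n} (hK : K ⊆ h) : h.image π = h := by
  rw [← Finset.sdiff_union_inter (h.image π) K, image_sdiff_of_permsOn hπ,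
    image_inter_of_permsOn hπ, Finset.inter_eq_right.2 hK]
  have : K.image π = K := by
    refine Finset.eq_of_subset_of_card_le (fun A hA => ?_) ?_
    · obtain ⟨B, hB, rfl⟩ := Finset.mem_image.1 hA
      exact (apply_mem_iff_of_permsOn hπ B).2 hB
    · rw [Finset.card_image_of_injective _ π.injective]
  rw [this, Finset.sdiff_union_of_subset hK]

lemma remove_image_of_permsOn {r : ℕ} {Z : Finset (Fin n)} {x : Fin n}
    {π : Equiv.Perm (Finset (Fin n))} (hπ : π ∈ permsOn (starEdges r Z x)) (h : Hyp n) :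
    remove (h.image π) Z = remove h Z := by
  ext A
  unfold remove
  rw [Finset.mem_filter, Finset.mem_filter]
  exact and_congr_left fun hA =>
    mem_image_of_permsOn hπ h fun hK => not_disjoint_of_mem_starEdges hK hA

/-- Star edges contribute to the degree at a vertex of `Z` through their number only. -/
lemma deg_image_of_permsOn {r : ℕ} {Z : Finset (Fin n)} {x : Fin n}
    {π : Equiv.Perm (Finset (Fin n))} (hπ : π ∈ permsOn (starEdges r Z x)) (h : Hyp n)
    {v : Fin n} (hv : v ∈ Z) : deg (h.image π) v = deg h v := by
  rw [← deg_sdiff_add_deg_inter (h.image π) (starEdges r Z x),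
    ← deg_sdiff_add_deg_inter h (starEdges r Z x), image_sdiff_of_permsOn hπ]
  have hstar : ∀ X : Hyp n, X ⊆ starEdges r Z x → deg X v = if v = x then X.card else 0 := by
    intro X hX
    split_ifs with hvx
    · subst hvx
      unfold deg
      rw [Finset.filter_true_of_mem fun A hA => mem_of_mem_starEdges (hX hA)]
    · unfold deg
      rw [Finset.card_eq_zero, Finset.filter_eq_empty_iff]
      exact fun A hA hvA => hvx (eq_of_mem_starEdges (hX hA) hvA hv)
  rw [hstar _ Finset.inter_subset_right, hstar _ Finset.inter_subset_right,
    image_inter_of_permsOn hπ, Finset.card_image_of_injective _ π.injective]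

/-- A set of edges covering the deficits `f` can be chosen with at most `∑ f` elements. -/
lemma exists_subset_forall_le_deg (V' : Finset (Fin n)) (f : Fin n → ℕ) (X : Hyp n)
    (hX : ∀ v ∈ V', f v ≤ deg X v) :
    ∃ Y ⊆ X, Y.card ≤ ∑ v ∈ V', f v ∧ ∀ v ∈ V', f v ≤ deg Y v := by
  have h1 : ∀ v, ∃ Y ⊆ X.filter fun A => v ∈ A, v ∈ V' → Y.card = f v := by
    intro v
    by_cases hv : v ∈ V'
    · obtain ⟨Y, hY, hc⟩ := Finset.exists_subset_card_eq (hX v hv)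
      exact ⟨Y, hY, fun _ => hc⟩
    · exact ⟨∅, Finset.empty_subset _, fun h => absurd h hv⟩
  choose Y hY hc using h1
  refine ⟨V'.biUnion Y, ?_, ?_, ?_⟩
  · exact Finset.biUnion_subset.2 fun v _ => (hY v).trans (Finset.filter_subset _ _)
  · exact Finset.card_biUnion_le.trans (Finset.sum_le_sum fun v hv => (hc v hv).le)
  · intro v hv
    rw [← hc v hv]
    refine Finset.card_le_card fun A hA =>
      Finset.mem_filter.2 ⟨?_, (Finset.mem_filter.1 (hY v hA)).2⟩
    exact Finset.mem_biUnion.2 ⟨v, hv, hA⟩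

/-- The sample space of the process without the degree condition on the final hypergraph. -/
def freeSamples (n r M : ℕ) : Finset (Hyp n × (Fin (stopT n r M) → Finset (Fin n))) :=
  Finset.univ.filter fun s =>
    s.1 ∈ (edgesOn r Finset.univ).powersetCard M ∧ Function.Injective s.2 ∧
      Finset.univ.image s.2 = edgesOn r Finset.univ \ s.1

lemma mem_samples {r M : ℕ} {δ : Fin n → ℕ} {s : Hyp n × (Fin (stopT n r M) → Finset (Fin n))} :
    s ∈ samples r M δ ↔ s ∈ freeSamples n r M ∧ MinDeg δ s.1 := by
  simp only [samples, freeSamples, finalGraphs, Finset.mem_filter, Finset.mem_univ, true_and]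
  tauto

lemma mem_freeSamples {r M : ℕ} {s : Hyp n × (Fin (stopT n r M) → Finset (Fin n))} :
    s ∈ freeSamples n r M ↔ (s.1 ⊆ edgesOn r Finset.univ ∧ s.1.card = M) ∧
      Function.Injective s.2 ∧ Finset.univ.image s.2 = edgesOn r Finset.univ \ s.1 := by
  simp only [freeSamples, Finset.mem_filter, Finset.mem_univ, true_and, Finset.mem_powersetCard]

lemma graphAt_subset (r M t : ℕ) (s : Hyp n × (Fin (stopT n r M) → Finset (Fin n))) :
    graphAt r M t s ⊆ edgesOn r Finset.univ :=
  Finset.sdiff_subset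

lemma fst_subset_graphAt {r M : ℕ} (t : ℕ) {s : Hyp n × (Fin (stopT n r M) → Finset (Fin n))}
    (hs : s ∈ freeSamples n r M) : s.1 ⊆ graphAt r M t s := by
  obtain ⟨⟨h1, -⟩, -, h3⟩ := mem_freeSamples.1 hs
  intro A hA
  refine Finset.mem_sdiff.2 ⟨h1 hA, fun hcon => ?_⟩
  have : A ∈ Finset.univ.image s.2 :=
    Finset.image_subset_image (Finset.filter_subset _ _) hcon
  rw [h3] at this
  exact (Finset.mem_sdiff.1 this).2 hA

lemma graphAt_stopT {r M : ℕ} {s : Hyp n × (Fin (stopT n r M) → Finset (Fin n))}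
    (hs : s ∈ freeSamples n r M) : graphAt r M (stopT n r M) s = s.1 := by
  obtain ⟨⟨h1, -⟩, -, h3⟩ := mem_freeSamples.1 hs
  unfold graphAt
  rw [Finset.filter_true_of_mem fun i _ => i.2, h3, Finset.sdiff_sdiff_eq_self h1]

/-- The action on samples of a permutation of the `r`-sets. -/
def act {T : ℕ} (π : Equiv.Perm (Finset (Fin n))) (s : Hyp n × (Fin T → Finset (Fin n))) :
    Hyp n × (Fin T → Finset (Fin n)) :=
  (s.1.image π, fun i => π (s.2 i))

lemma act_inv_act {T : ℕ} (π : Equiv.Perm (Finset (Fin n)))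
    (s : Hyp n × (Fin T → Finset (Fin n))) : act π⁻¹ (act π s) = s := by
  refine Prod.ext ?_ ?_
  · simp [act, Finset.image_image, Function.comp_def]
  · simp [act]

lemma act_mem_freeSamples {r M : ℕ} {K : Hyp n} (hK : K ⊆ edgesOn r Finset.univ)
    {π : Equiv.Perm (Finset (Fin n))} (hπ : π ∈ permsOn K)
    {s : Hyp n × (Fin (stopT n r M) → Finset (Fin n))} (hs : s ∈ freeSamples n r M) :
    act π s ∈ freeSamples n r M := by
  obtain ⟨⟨h1, h2⟩, h3, h4⟩ := mem_freeSamples.1 hs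
  have hE := image_eq_of_permsOn hπ hK
  refine mem_freeSamples.2 ⟨⟨?_, ?_⟩, π.injective.comp h3, ?_⟩
  · rw [← hE]
    exact Finset.image_subset_image h1
  · rw [act, Finset.card_image_of_injective _ π.injective, h2]
  · have : Finset.univ.image (act π s).2 = (Finset.univ.image s.2).image π := by
      rw [Finset.image_image]; rfl
    rw [this, h4, Finset.image_sdiff _ _ π.injective, hE]
    rfl

lemma graphAt_act {r M t : ℕ} {K : Hyp n} (hK : K ⊆ edgesOn r Finset.univ)
    {π : Equiv.Perm (Finset (Fin n))} (hπ : π ∈ permsOn K)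
    (s : Hyp n × (Fin (stopT n r M) → Finset (Fin n))) :
    graphAt r M t (act π s) = (graphAt r M t s).image π := by
  unfold graphAt
  rw [Finset.image_sdiff _ _ π.injective, image_eq_of_permsOn hπ hK, Finset.image_image]
  rfl

/-- An event is on average as frequent along the orbits of `permsOn K` as it is in the whole of
`freeSamples`. -/
lemma sum_card_act_eq {r M : ℕ} {K : Hyp n} (hK : K ⊆ edgesOn r Finset.univ)
    (E : Hyp n × (Fin (stopT n r M) → Finset (Fin n)) → Prop) [DecidablePred E] :
    ∑ s ∈ freeSamples n r M, ((permsOn K).filter fun π => E (act π s)).card =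
      (permsOn K).card * ((freeSamples n r M).filter E).card := by
  simp only [Finset.card_filter (fun π => E (act π _))]
  rw [Finset.sum_comm]
  simp only [← Finset.card_filter]
  rw [← smul_eq_mul, ← Finset.sum_const]
  refine Finset.sum_congr rfl fun π hπ => ?_
  refine Finset.card_bij' (fun s _ => act π s) (fun s _ => act π⁻¹ s) ?_ ?_ ?_ ?_
  · intro s hs
    rw [Finset.mem_filter] at hs ⊢
    exact ⟨act_mem_freeSamples hK hπ hs.1, hs.2⟩
  · intro s hs
    rw [Finset.mem_filter] at hs ⊢
    refine ⟨act_mem_freeSamples hK (permsOn_inv hπ) hs.1, ?_⟩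
    have := act_inv_act π⁻¹ s
    rw [inv_inv] at this
    rw [this]
    exact hs.2
  · intro s _
    exact act_inv_act π s
  · intro s _
    have := act_inv_act π⁻¹ s
    rwa [inv_inv] at this

lemma starEdges_subset (r : ℕ) (Z : Finset (Fin n)) (x : Fin n) :
    starEdges r Z x ⊆ edgesOn r Finset.univ :=
  Finset.filter_subset _ _

open Classical in
/-- Along the orbit of a sample that is not deficient, conditioning on the minimum degrees
concerns the positions of at most `w` star edges, so `H_t` remains unlikely to have many star edges
in a given small set `B`. -/
lemma card_act_inter_le {r M t : ℕ} {δ : Fin n → ℕ} {Z : Finset (Fin n)} {x : Fin n}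
    {s : Hyp n × (Fin (stopT n r M) → Finset (Fin n))} (hs : s ∈ freeSamples n r M)
    {w q L : ℕ}
    (hw : ∑ v ∈ Finset.univ \ Z, (δ v - deg (remove s.1 Z) v) ≤ w)
    (hL : L + w + q ≤ (starEdges r Z x).card) (B : Hyp n) (hB : B ⊆ starEdges r Z x) :
    L ^ q * ((permsOn (starEdges r Z x)).filter fun π =>
        act π s ∈ samples r M δ ∧ w + q ≤ (graphAt r M t (act π s) ∩ B).card).card ≤
      4 ^ (graphAt r M t s ∩ starEdges r Z x).card *
        (B.card ^ q * ((permsOn (starEdges r Z x)).filter fun π =>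
          act π s ∈ samples r M δ).card) := by
  set K := starEdges r Z x with hKdef
  have hK : K ⊆ edgesOn r Finset.univ := starEdges_subset r Z x
  set P : Hyp n → Prop := fun X =>
    (∀ v ∈ Z, δ v ≤ deg s.1 v) ∧ ∀ v ∈ Finset.univ \ Z, δ v - deg (s.1 \ K) v ≤ deg X v with hP
  have hmem : ∀ π ∈ permsOn K, (act π s ∈ samples r M δ ↔ P ((s.1 ∩ K).image π)) := by
    intro π hπ
    rw [mem_samples, and_iff_right (act_mem_freeSamples hK hπ hs)]
    have hd : ∀ v, deg (act π s).1 v = deg (s.1 \ K) v + deg ((s.1 ∩ K).image π) v := by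
      intro v
      rw [← image_inter_of_permsOn hπ, ← image_sdiff_of_permsOn hπ, deg_sdiff_add_deg_inter]
      rfl
    constructor
    · intro h
      refine ⟨fun v hv => ?_, fun v _ => ?_⟩
      · rw [← deg_image_of_permsOn hπ s.1 hv]
        exact h v
      · have := h v
        rw [hd v] at this
        omega
    · rintro ⟨h1, h2⟩ v
      by_cases hv : v ∈ Z
      · exact (h1 v hv).trans (deg_image_of_permsOn hπ s.1 hv).ge
      · have := h2 v (by simpa using hv)
        rw [hd v]
        omega
  have hinter : ∀ π ∈ permsOn K, graphAt r M t (act π s) ∩ B =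
      (graphAt r M t s ∩ K).image π ∩ B := by
    intro π hπ
    rw [graphAt_act hK hπ, ← image_inter_of_permsOn hπ, Finset.inter_assoc,
      Finset.inter_eq_right.2 hB]
  have hrem : remove s.1 Z ⊆ s.1 \ K := by
    intro A hA
    obtain ⟨hA, hd⟩ := Finset.mem_filter.1 hA
    exact Finset.mem_sdiff.2 ⟨hA, fun h => not_disjoint_of_mem_starEdges h hd⟩
  have main := card_permsOn_inter_le (K := K) (S := graphAt r M t s ∩ K) (J := s.1 ∩ K) (B := B)
    (Finset.inter_subset_inter_right (fst_subset_graphAt t hs)) Finset.inter_subset_right P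
    (fun X Y hXY hX => ⟨hX.1, fun v hv => (hX.2 v hv).trans (deg_mono hXY v)⟩)
    (w := w) (q := q) (L := L) (fun X _ hX => by
      obtain ⟨Y, hYX, hYc, hY⟩ := exists_subset_forall_le_deg (Finset.univ \ Z)
        (fun v => δ v - deg (s.1 \ K) v) X hX.2
      refine ⟨Y, hYX, hYc.trans (le_trans (Finset.sum_le_sum fun v _ => ?_) hw), hX.1, hY⟩
      exact Nat.sub_le_sub_left (deg_mono hrem v) _) hL
  have e1 : ((permsOn K).filter fun π =>
      act π s ∈ samples r M δ ∧ w + q ≤ (graphAt r M t (act π s) ∩ B).card) =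
      (permsOn K).filter fun π : Equiv.Perm (Finset (Fin n)) => P ((s.1 ∩ K).image π) ∧
        w + q ≤ ((graphAt r M t s ∩ K).image π ∩ B).card :=
    Finset.filter_congr fun π hπ => by rw [hmem π hπ, hinter π hπ]
  have e2 : ((permsOn K).filter fun π => act π s ∈ samples r M δ) =
      (permsOn K).filter fun π : Equiv.Perm (Finset (Fin n)) => P ((s.1 ∩ K).image π) :=
    Finset.filter_congr fun π hπ => hmem π hπ
  rw [e1, e2]
  convert main

lemma card_filter_le_of_condProb_lt {Ω : Type*} {S : Finset Ω} {p q : Ω → Prop}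
    [DecidablePred p] [DecidablePred q] {a : ℝ} (h : condProb S p q < a)
    (hne : (S.filter q).Nonempty) :
    (((S.filter q).filter p).card : ℝ) ≤ a * (S.filter q).card := by
  have hpos : (0 : ℝ) < (S.filter q).card := by exact_mod_cast Finset.card_pos.2 hne
  rw [← div_le_iff₀ hpos]
  unfold condProb prob at h
  convert h.le

open Classical in
/-- Summing the last property in `ℜ` over the possible values of `H_t - Z`: it is unlikely that
`H_t` has this property and yet the final hypergraph is deficient. -/
lemma card_propR4_deficient_le {r M t : ℕ} {δ : Fin n → ℕ} {ω η : ℝ} {Z : Finset (Fin n)}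
    (hZ : Z ∈ edgesOn r (Finset.univ : Finset (Fin n))) :
    (((samples r M δ).filter fun s => PropR4 r M δ ω η t (graphAt r M t s) ∧
        Deficient δ ω Z (graphAt r M (stopT n r M) s)).card : ℝ) ≤
      (n : ℝ) ^ (-(η * ω / 2)) * (samples r M δ).card := by
  set Ω := samples r M δ
  set f : Hyp n × (Fin (stopT n r M) → Finset (Fin n)) → Hyp n :=
    fun s => remove (graphAt r M t s) Z with hf
  set X := Ω.filter fun s => PropR4 r M δ ω η t (graphAt r M t s) ∧
        Deficient δ ω Z (graphAt r M (stopT n r M) s) with hX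
  rw [Finset.card_eq_sum_card_image f Ω,
    Finset.card_eq_sum_card_fiberwise (s := X) (f := f) (t := Ω.image f) (fun s hs =>
      Finset.mem_coe.2 (Finset.mem_image_of_mem f (Finset.filter_subset _ _ hs)))]
  push_cast
  rw [Finset.mul_sum]
  refine Finset.sum_le_sum fun g _ => ?_
  rcases (X.filter fun s => f s = g).eq_empty_or_nonempty with he | ⟨s₀, hs₀⟩
  · rw [he]
    simp only [Finset.card_empty, Nat.cast_zero]
    positivity
  · obtain ⟨hs₁, rfl⟩ := Finset.mem_filter.1 hs₀
    rw [hX, Finset.mem_filter] at hs₁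
    have hlt := hs₁.2.1 Z hZ
    refine le_trans ?_ (card_filter_le_of_condProb_lt hlt ⟨s₀, Finset.mem_filter.2 ⟨hs₁.1, rfl⟩⟩)
    norm_cast
    refine Finset.card_le_card fun s hs => ?_
    simp only [hX, Finset.mem_filter] at hs ⊢
    exact ⟨⟨hs.1.1, hs.2⟩, hs.1.2.2⟩

end Orbits

/-! ### The probability that the swap inequality fails -/

section Failure

variable {n : ℕ}

/-- The part of the failure event that is estimated on each orbit of the permutations of the star
edges: the final hypergraph is not deficient, `H_t` is regular and `H_t - Z` satisfies `𝔉`, but the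
swap inequality fails for too many vertices. -/
def SwapFailure (r M t : ℕ) (δ : Fin n → ℕ) (ε θ C c ω θ' : ℝ) (Z : Finset (Fin n)) (x : Fin n)
    (s : Hyp n × (Fin (stopT n r M) → Finset (Fin n))) : Prop :=
  s ∈ samples r M δ ∧ ¬ Deficient δ ω Z (graphAt r M (stopT n r M) s) ∧
    PropR0 r ε θ C c (graphAt r M t s) ∧
    PropF θ r (Finset.univ \ Z) (remove (graphAt r M t s) Z) ∧
    ¬ SwapBound θ' r (graphAt r M t s) Z x

open Classical in
/-- On each orbit, a failure requires that one of the at most `n` typical vertices `y` sees at least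
`⌈γ' S⌉` bad star edges in `H_t`, where `S` is the number of star edges of `H_t`. Both `S` and
`H_t - Z` are constant on the orbit, so the bad edges of each `y` form a fixed set. -/
lemma card_act_swapFailure_le {r M t : ℕ} {δ : Fin n → ℕ} {ε θ C c ω γ γ' θ' ρ : ℝ}
    (hε : 0 < ε) (hc : 0 < c) {Z : Finset (Fin n)}
    (hZ : Z ∈ edgesOn r (Finset.univ : Finset (Fin n))) {x : Fin n} (hx : x ∈ Z) (hrn : r < n)
    (hM : 0 < M) (hγ : 0 < γ) (hγ' : 0 ≤ γ') (hγ'1 : γ' ≤ 1) (hθ : |θ| ≤ 1)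
    (hθr : r * |θ| / (c * ε) ≤ 1 / 2)
    (hθ' : γ' + |θ| + r * |θ| / (c * ε) + r / n ≤ θ') (hγθ' : γ ≤ θ')
    (hγθ : r + |θ| * ((n : ℝ) - r) ≤ γ ^ 2 * ((n : ℝ) - r))
    (hnum : ∀ S : ℕ, c * ε * (r * M / n) / 2 ≤ S → ⌊ω⌋₊ ≤ ⌈γ' * S⌉₊ ∧ 2 * ⌈γ' * S⌉₊ ≤ S ∧
      (4 : ℝ) ^ S * (2 * γ) ^ (⌈γ' * S⌉₊ - ⌊ω⌋₊) ≤ ρ)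
    {s : Hyp n × (Fin (stopT n r M) → Finset (Fin n))} (hs : s ∈ freeSamples n r M) :
    (((permsOn (starEdges r Z x)).filter fun π =>
        SwapFailure r M t δ ε θ C c ω θ' Z x (act π s)).card : ℝ) ≤
      n * ρ * ((permsOn (starEdges r Z x)).filter fun π => act π s ∈ samples r M δ).card := by
  set K := starEdges r Z x with hKdef
  have hK : K ⊆ edgesOn r Finset.univ := starEdges_subset r Z x
  have hZc : Z.card = r := (mem_edgesOn.1 hZ).2
  have hr : 1 ≤ r := hZc ▸ Finset.card_pos.2 ⟨x, hx⟩
  have hn : 0 < n := by omega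
  set E := (permsOn K).filter fun π => SwapFailure r M t δ ε θ C c ω θ' Z x (act π s) with hE
  set G := (permsOn K).filter fun π => act π s ∈ samples r M δ with hG
  set h := graphAt r M t s with hh
  set g := remove h Z with hg
  set S := h ∩ K with hS
  set W := Finset.univ \ Z with hW
  have hSK : S.card ≤ K.card := Finset.card_le_card Finset.inter_subset_right
  -- The quantities below are constant along the orbit.
  have hgraph : ∀ π ∈ permsOn K, graphAt r M t (act π s) = h.image π :=
    fun π hπ => graphAt_act hK hπ s
  have hremove : ∀ π ∈ permsOn K, remove (graphAt r M t (act π s)) Z = g := by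
    intro π hπ
    rw [hgraph π hπ, remove_image_of_permsOn hπ]
  have hScard : ∀ π ∈ permsOn K, (graphAt r M t (act π s) ∩ K).card = S.card := by
    intro π hπ
    rw [hgraph π hπ, image_inter_of_permsOn hπ, Finset.card_image_of_injective _ π.injective]
  have hdef : ∀ π ∈ permsOn K,
      (Deficient δ ω Z (graphAt r M (stopT n r M) (act π s)) ↔ Deficient δ ω Z s.1) := by
    intro π hπ
    rw [graphAt_stopT (act_mem_freeSamples hK hπ hs)]
    unfold Deficient
    rw [show remove (act π s).1 Z = remove s.1 Z from remove_image_of_permsOn hπ s.1]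
  rcases E.eq_empty_or_nonempty with hemp | ⟨π₀, hπ₀⟩
  · have hρ : 0 ≤ ρ := by
      obtain ⟨S₀, hS₀⟩ := exists_nat_ge (c * ε * (r * M / n) / 2)
      exact le_trans (by positivity) (hnum S₀ hS₀).2.2
    rw [hemp, Finset.card_empty, Nat.cast_zero]
    positivity
  obtain ⟨hπ₀, -, hD₀, hR₀, hF₀, -⟩ := Finset.mem_filter.1 hπ₀
  rw [hremove π₀ hπ₀] at hF₀
  rw [hdef π₀ hπ₀] at hD₀
  have hSlow : c * ε * (r * M / n) / 2 ≤ S.card := by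
    have h1 := mul_deg_le_card_inter_starEdges hε hc (graphAt_subset r M t _) hR₀ hZc hx
    rw [hScard π₀ hπ₀] at h1
    have h2 := hR₀.min_deg x
    have h3 : (r * M / n : ℝ) ≤ avgDeg r Finset.univ (graphAt r M t (act π₀ s)) := by
      rw [avgDeg, Finset.card_univ, Fintype.card_fin]
      gcongr
      rw [hgraph π₀ hπ₀, Finset.card_image_of_injective _ π₀.injective,
        ← (mem_freeSamples.1 hs).1.2]
      exact Finset.card_le_card (fst_subset_graphAt t hs)
    have h4 : c * ε * (r * M / n) ≤ deg (graphAt r M t (act π₀ s)) x :=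
      le_trans (by gcongr) h2
    have h5 : (1 / 2 : ℝ) * deg (graphAt r M t (act π₀ s)) x ≤ S.card :=
      le_trans (by gcongr; linarith) h1
    linarith
  have hSpos : 0 < S.card := by
    have : (0 : ℝ) < S.card := lt_of_lt_of_le (by positivity) hSlow
    exact_mod_cast this
  obtain ⟨hwm, hmS, hρ⟩ := hnum S.card hSlow
  set w := ⌊ω⌋₊ with hw
  set q := ⌈γ' * S.card⌉₊ - w with hq
  have hwq : w + q = ⌈γ' * S.card⌉₊ := by omega
  set L := K.card - (w + q) with hL
  have hLK : L + w + q ≤ K.card := by omega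
  have hKL : K.card ≤ 2 * L := by omega
  have hLpos : 0 < L := by omega
  have hdefw : ∑ v ∈ Finset.univ \ Z, (δ v - deg (remove s.1 Z) v) ≤ w := by
    unfold Deficient at hD₀
    exact Nat.le_floor (not_lt.1 hD₀)
  have hWc : (W.card : ℝ) = n - r := by
    rw [hW, Finset.card_sdiff_of_subset (Finset.subset_univ Z), hZc, Finset.card_univ,
      Fintype.card_fin, Nat.cast_sub hrn.le]
  set Y := W.filter fun y => ((badStar θ r Z x g y).card : ℝ) ≤ γ * K.card with hY
  set A : Fin n → Finset (Equiv.Perm (Finset (Fin n))) := fun y => (permsOn K).filter fun π =>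
    act π s ∈ samples r M δ ∧
      w + q ≤ (graphAt r M t (act π s) ∩ badStar θ r Z x g y).card with hA
  have hcover : E ⊆ Y.biUnion A := by
    intro π hπ
    obtain ⟨hπ, hsam, -, hR, -, hsw⟩ := Finset.mem_filter.1 hπ
    by_contra hcon
    refine hsw ?_
    have htyp := almostAll_card_badStar_le hr hx hF₀ hγ (by rw [hWc]; exact hγθ)
      (hSpos.trans_le hSK)
    unfold SwapBound AlmostAll
    unfold AlmostAll at htyp
    refine le_trans (Nat.cast_le.2 (Finset.card_le_card ?_))
      (htyp.trans (mul_le_mul_of_nonneg_right hγθ' (Nat.cast_nonneg _)))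
    refine Finset.monotone_filter_right _ fun y hyW => ?_
    refine not_imp_not.2 fun hy => ?_
    have hyZ : y ∉ Z := (Finset.mem_sdiff.1 hyW).2
    have hyA : π ∉ A y := fun hmem =>
      hcon (Finset.mem_biUnion.2 ⟨y, Finset.mem_filter.2 ⟨hyW, hy⟩, hmem⟩)
    refine swap_le_weight hε hc (graphAt_subset r M t _) hR hZc hx hyZ hrn hγ' hγ'1 hθ
      (hθr.trans (by norm_num)) hθ' ?_
    rw [hremove π hπ, hScard π hπ]
    have h1 : (graphAt r M t (act π s) ∩ badStar θ r Z x g y).card < ⌈γ' * S.card⌉₊ := by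
      by_contra hge
      exact hyA (Finset.mem_filter.2 ⟨hπ, hsam, by omega⟩)
    exact (Nat.lt_ceil.1 h1).le
  have hLR : (0 : ℝ) < L := by exact_mod_cast hLpos
  have hKLR : (K.card : ℝ) ≤ 2 * L := by exact_mod_cast hKL
  have hAy : ∀ y ∈ Y, ((A y).card : ℝ) ≤ ρ * G.card := by
    intro y hy
    have h1 := card_act_inter_le (t := t) hs hdefw hLK (badStar θ r Z x g y)
      (Finset.filter_subset _ _)
    have h2 : (L : ℝ) ^ q * (A y).card ≤
        4 ^ S.card * ((badStar θ r Z x g y).card ^ q * G.card) := by exact_mod_cast h1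
    have h3 : ((badStar θ r Z x g y).card : ℝ) ≤ 2 * γ * L := by
      calc ((badStar θ r Z x g y).card : ℝ) ≤ γ * K.card := (Finset.mem_filter.1 hy).2
        _ ≤ γ * (2 * L) := by gcongr
        _ = 2 * γ * L := by ring
    have h4 : (L : ℝ) ^ q * (A y).card ≤ (L : ℝ) ^ q * (ρ * G.card) := by
      calc (L : ℝ) ^ q * (A y).card
          ≤ 4 ^ S.card * ((badStar θ r Z x g y).card ^ q * G.card) := h2
        _ ≤ 4 ^ S.card * ((2 * γ * L) ^ q * G.card) := by gcongr
        _ = (L : ℝ) ^ q * ((4 ^ S.card * (2 * γ) ^ q) * G.card) := by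
            rw [mul_pow (2 * γ)]; ring
        _ ≤ (L : ℝ) ^ q * (ρ * G.card) := by gcongr
    exact le_of_mul_le_mul_left h4 (by positivity)
  have hρ0 : 0 ≤ ρ := le_trans (by positivity) hρ
  calc (E.card : ℝ) ≤ ∑ y ∈ Y, ((A y).card : ℝ) := by
        exact_mod_cast (Finset.card_le_card hcover).trans Finset.card_biUnion_le
    _ ≤ ∑ y ∈ Y, ρ * G.card := Finset.sum_le_sum hAy
    _ = Y.card * (ρ * G.card) := by simp
    _ ≤ n * (ρ * G.card) := by
        gcongr
        simpa using Finset.card_le_univ Y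
    _ = n * ρ * G.card := by ring

open Classical in
/-- A bound on every orbit, relative to the samples in it, is a bound on the probability. -/
lemma card_swapFailure_le {r M t : ℕ} {δ : Fin n → ℕ} {ε θ C c ω θ' b : ℝ}
    {Z : Finset (Fin n)} {x : Fin n}
    (horb : ∀ s ∈ freeSamples n r M, (((permsOn (starEdges r Z x)).filter fun π =>
        SwapFailure r M t δ ε θ C c ω θ' Z x (act π s)).card : ℝ) ≤
      b * ((permsOn (starEdges r Z x)).filter fun π => act π s ∈ samples r M δ).card) :
    (((freeSamples n r M).filter (SwapFailure r M t δ ε θ C c ω θ' Z x)).card : ℝ) ≤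
      b * (samples r M δ).card := by
  set K := starEdges r Z x
  have hK : K ⊆ edgesOn r Finset.univ := starEdges_subset r Z x
  have h1 := sum_card_act_eq hK (SwapFailure r M t δ ε θ C c ω θ' Z x)
  have h2 := sum_card_act_eq (M := M) hK (fun s => s ∈ samples r M δ)
  have h3 : (freeSamples n r M).filter (fun s => s ∈ samples r M δ) = samples r M δ := by
    ext s
    rw [Finset.mem_filter, and_iff_right_of_imp fun h => (mem_samples.1 h).1]
  rw [h3] at h2
  have hG : (0 : ℝ) < (permsOn K).card := by
    exact_mod_cast Finset.card_pos.2 ⟨1, one_mem_permsOn K⟩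
  have h4 : ((permsOn K).card : ℝ) *
      ((freeSamples n r M).filter (SwapFailure r M t δ ε θ C c ω θ' Z x)).card ≤
      (permsOn K).card * (b * (samples r M δ).card) := by
    calc ((permsOn K).card : ℝ) *
          ((freeSamples n r M).filter (SwapFailure r M t δ ε θ C c ω θ' Z x)).card
        = ∑ s ∈ freeSamples n r M, (((permsOn K).filter fun π =>
            SwapFailure r M t δ ε θ C c ω θ' Z x (act π s)).card : ℝ) := by
          exact_mod_cast h1.symm
      _ ≤ ∑ s ∈ freeSamples n r M,
            b * ((permsOn K).filter fun π => act π s ∈ samples r M δ).card :=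
          Finset.sum_le_sum horb
      _ = b * ((permsOn K).card * (samples r M δ).card) := by
          rw [← Finset.mul_sum]
          congr 1
          exact_mod_cast h2
      _ = _ := by ring
  exact le_of_mul_le_mul_left h4 hG

end Failure

/-! ### Choice of the error terms -/

/-- The proportion of bad star edges to be tolerated, when a typical vertex has a proportion `γ` of
bad `r`-sets: it tends to zero so slowly that it dominates both `1 / log (1 / γ)` and
`ω / log n`. -/
noncomputable def tolerance (γ ω : ℕ → ℝ) (n : ℕ) : ℝ :=
  (√(-Real.log (2 * γ n)))⁻¹ + √(|ω n| / Real.log n)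

lemma tendsto_neg_log_two_mul {γ : ℕ → ℝ} (hγ : Tendsto γ atTop (𝓝 0))
    (hpos : ∀ᶠ n in atTop, 0 < γ n) :
    Tendsto (fun n => √(-Real.log (2 * γ n))) atTop atTop := by
  refine Real.tendsto_sqrt_atTop.comp (tendsto_neg_atBot_atTop.comp ?_)
  refine Real.tendsto_log_nhdsGT_zero.comp (tendsto_nhdsWithin_iff.2 ⟨?_, ?_⟩)
  · simpa using hγ.const_mul 2
  · filter_upwards [hpos] with n hn
    simpa using hn

lemma tendsto_natCast_log : Tendsto (fun n : ℕ => Real.log n) atTop atTop :=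
  Real.tendsto_log_atTop.comp tendsto_natCast_atTop_atTop

lemma tendsto_sqrt_div_log {ω : ℕ → ℝ} (hω : ω =o[atTop] fun n : ℕ => Real.log n) :
    Tendsto (fun n => √(|ω n| / Real.log n)) atTop (𝓝 0) := by
  have h := hω.norm_left.tendsto_div_nhds_zero
  have h2 := (Real.continuous_sqrt.tendsto 0).comp h
  rw [Real.sqrt_zero] at h2
  exact h2

lemma tendsto_tolerance {γ ω : ℕ → ℝ} (hγ : Tendsto γ atTop (𝓝 0))
    (hpos : ∀ᶠ n in atTop, 0 < γ n) (hω : ω =o[atTop] fun n : ℕ => Real.log n) :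
    Tendsto (tolerance γ ω) atTop (𝓝 0) := by
  have h := (tendsto_neg_log_two_mul hγ hpos).inv_tendsto_atTop.add (tendsto_sqrt_div_log hω)
  rw [add_zero] at h
  exact h

lemma tolerance_nonneg (γ ω : ℕ → ℝ) (n : ℕ) : 0 ≤ tolerance γ ω n := by
  unfold tolerance
  positivity

/-- The tolerated proportion makes the large deviation bound smaller than every power of `n`. -/
lemma eventually_tolerance_bound {γ ω : ℕ → ℝ} (hγ : Tendsto γ atTop (𝓝 0))
    (hpos : ∀ᶠ n in atTop, 0 < γ n) (hω : ω =o[atTop] fun n : ℕ => Real.log n)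
    {κ : ℝ} (hκ : 0 < κ) (k : ℕ) :
    ∀ᶠ n : ℕ in atTop, ∀ S : ℕ, κ * Real.log n ≤ S →
      ⌊ω n⌋₊ ≤ ⌈tolerance γ ω n * S⌉₊ ∧ 2 * ⌈tolerance γ ω n * S⌉₊ ≤ S ∧
      (4 : ℝ) ^ S * (2 * γ n) ^ (⌈tolerance γ ω n * S⌉₊ - ⌊ω n⌋₊) ≤ ((n : ℝ) ^ k)⁻¹ := by
  have hΛ := tendsto_neg_log_two_mul hγ hpos
  filter_upwards [hpos, tendsto_natCast_log.eventually_ge_atTop 1,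
    tendsto_natCast_log.eventually_ge_atTop (4 / κ),
    (tendsto_sqrt_div_log hω).eventually_le_const (show (0 : ℝ) < κ / 2 by positivity),
    (tendsto_tolerance hγ hpos hω).eventually_le_const (show (0 : ℝ) < 1 / 4 by norm_num),
    hΛ.eventually_ge_atTop (2 * (k / κ + 2)), eventually_ge_atTop 1]
    with n hγn hlog hlogκ hu htol hΛn hn S hS
  set γ' := tolerance γ ω n with hγ'
  set l := Real.log n with hl
  set Λ := -Real.log (2 * γ n) with hΛdef
  set u := √(|ω n| / l) with hudef
  have hu0 : 0 ≤ u := Real.sqrt_nonneg _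
  have hγ'0 : 0 ≤ γ' := tolerance_nonneg γ ω n
  have hγ'e : γ' = (√Λ)⁻¹ + u := rfl
  have hΛ4 : 4 ≤ √Λ := by
    have : 0 ≤ (k : ℝ) / κ := by positivity
    linarith
  have huγ : u ≤ γ' := by
    have : 0 ≤ (√Λ)⁻¹ := by positivity
    linarith
  have hω1 : |ω n| ≤ γ' * S / 2 := by
    have h1 : u * u = |ω n| / l := Real.mul_self_sqrt (by positivity)
    have h2 : |ω n| = u * (u * l) := by
      rw [← mul_assoc, h1]; field_simp
    calc |ω n| = u * (u * l) := h2
      _ ≤ γ' * (κ / 2 * l) := by gcongr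
      _ = γ' * (κ * l) / 2 := by ring
      _ ≤ γ' * S / 2 := by gcongr
  have hfloor : (⌊ω n⌋₊ : ℝ) ≤ γ' * S / 2 := by
    rcases le_total 0 (ω n) with h0 | h0
    · exact (Nat.floor_le h0).trans ((le_abs_self _).trans hω1)
    · rw [Nat.floor_of_nonpos h0, Nat.cast_zero]
      positivity
  have hceil : γ' * S ≤ (⌈γ' * S⌉₊ : ℝ) := Nat.le_ceil _
  have hγS : 0 ≤ γ' * S := by positivity
  have hle : ⌊ω n⌋₊ ≤ ⌈γ' * S⌉₊ := by
    have : (⌊ω n⌋₊ : ℝ) ≤ ⌈γ' * S⌉₊ := by linarith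
    exact_mod_cast this
  have hS4 : (4 : ℝ) ≤ S := by
    refine le_trans ?_ hS
    rw [div_le_iff₀ hκ] at hlogκ
    linarith
  refine ⟨hle, ?_, ?_⟩
  · have h1 : (⌈γ' * S⌉₊ : ℝ) < γ' * S + 1 := Nat.ceil_lt_add_one hγS
    have h2 : γ' * S ≤ 1 / 4 * S := by gcongr
    have h3 : (2 * ⌈γ' * S⌉₊ : ℝ) ≤ S := by linarith
    exact_mod_cast h3
  · have hq : γ' * S / 2 ≤ ((⌈γ' * S⌉₊ - ⌊ω n⌋₊ : ℕ) : ℝ) := by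
      rw [Nat.cast_sub hle]
      linarith
    set q := ⌈γ' * S⌉₊ - ⌊ω n⌋₊
    have hΛ0 : 0 < Λ := Real.sqrt_pos.1 (by linarith)
    have h4 : (4 : ℝ) ≤ Real.exp 2 := by
      have h1 := Real.add_one_le_exp (1 : ℝ)
      have h2 : Real.exp 2 = Real.exp 1 * Real.exp 1 := by rw [← Real.exp_add]; norm_num
      rw [h2]
      nlinarith
    have hγe : 2 * γ n = Real.exp (-Λ) := by
      rw [hΛdef, neg_neg, Real.exp_log (by positivity)]
    have hΛγ : √Λ ≤ Λ * γ' := by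
      have h1 : Λ * (√Λ)⁻¹ = √Λ := by
        rw [← div_eq_mul_inv, Real.div_sqrt]
      calc √Λ = Λ * (√Λ)⁻¹ := h1.symm
        _ ≤ Λ * γ' := by
          gcongr
          linarith
    have hmain : (k : ℝ) * l ≤ Λ * q - 2 * S := by
      have h1 : √Λ * S / 2 ≤ Λ * q := by
        calc √Λ * S / 2 ≤ Λ * γ' * S / 2 := by gcongr
          _ = Λ * (γ' * S / 2) := by ring
          _ ≤ Λ * q := by gcongr
      have h2 : (k : ℝ) / κ ≤ √Λ / 2 - 2 := by linarith
      have h3 : (k : ℝ) / κ * (κ * l) ≤ (√Λ / 2 - 2) * S := by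
        have : 0 ≤ (k : ℝ) / κ := by positivity
        gcongr
        linarith
      have h5 : (k : ℝ) / κ * (κ * l) = k * l := by field_simp
      linarith
    have hnk : ((n : ℝ) ^ k)⁻¹ = Real.exp (-(k * l)) := by
      rw [Real.exp_neg, mul_comm, Real.exp_mul, hl, Real.exp_log (by exact_mod_cast hn),
        Real.rpow_natCast]
    calc (4 : ℝ) ^ S * (2 * γ n) ^ q ≤ Real.exp 2 ^ S * Real.exp (-Λ) ^ q := by
          rw [hγe]; gcongr
      _ = Real.exp (-(Λ * q - 2 * S)) := by
          rw [← Real.exp_nat_mul, ← Real.exp_nat_mul, ← Real.exp_add]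
          congr 1
          ring
      _ ≤ ((n : ℝ) ^ k)⁻¹ := by
          rw [hnk, Real.exp_le_exp]
          linarith

end Shamir

theorem mainTheorem5 (r : ℕ) (hr : 3 ≤ r) :
    ∃ ε₀ : ℝ, 0 < ε₀ ∧ ∀ ε : ℝ, 0 < ε → ε < ε₀ →
      ∀ (C c η : ℝ) (θ ω : ℕ → ℝ), 0 < C → 0 < c → 0 < η →
        Tendsto θ atTop (𝓝 0) → Tendsto ω atTop atTop →
        (ω =o[atTop] fun n : ℕ => Real.log n) →
        ∃ θ' : ℕ → ℝ, Tendsto θ' atTop (𝓝 0) ∧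
          ∀ k : ℕ, ∀ᶠ n : ℕ in atTop, r ∣ n →
            ∀ (M : ℕ) (δ : Fin n → ℕ),
              Shamir.Approx (θ n) M ((n : ℝ) / r * Real.log n) →
              (∀ x, Shamir.Approx (θ n) (δ x) (ε * Real.log n)) →
              ∀ t : ℕ, 1 ≤ t → t ≤ Shamir.stopT n r M →
                ∀ Z ∈ Shamir.edgesOn r (Finset.univ : Finset (Fin n)), ∀ x ∈ Z,
                  Shamir.prob (Shamir.samples r M δ) (fun s =>
                      Shamir.PropR r M δ ε (θ n) C c (ω n) η t (Shamir.graphAt r M t s) ∧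
                      Shamir.PropF (θ n) r (Finset.univ \ Z)
                        (Shamir.remove (Shamir.graphAt r M t s) Z) ∧
                      ¬ Shamir.SwapBound (θ' n) r (Shamir.graphAt r M t s) Z x)
                    ≤ ((n : ℝ) ^ k)⁻¹ := by
  classical
  -- The estimates hold for every fixed `ε`, so any positive `ε₀` serves.
  refine ⟨1, one_pos, fun ε hε _ C c η θ ω _ hc hη hθ hω hωlog => ?_⟩
  have hr0 : (0 : ℝ) < r := by exact_mod_cast (by omega : 0 < r)
  -- `γ ^ 2` is the average proportion of bad star edges, so that Markov's inequality leaves at most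
  -- a `γ`-fraction of vertices with a proportion of bad star edges above `γ`.
  set γ : ℕ → ℝ := fun n => √(|θ n| + 2 * r / n) with hγdef
  have hθabs : Tendsto (fun n => |θ n|) atTop (𝓝 0) := by simpa using hθ.abs
  have hrdiv : ∀ a : ℝ, Tendsto (fun n : ℕ => a / (n : ℝ)) atTop (𝓝 0) := fun a =>
    tendsto_const_div_atTop_nhds_zero_nat a
  have hγ : Tendsto γ atTop (𝓝 0) := by
    have h := (hθabs.add (hrdiv (2 * r))).sqrt
    simpa using h
  have hγpos : ∀ᶠ n in atTop, 0 < γ n := by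
    filter_upwards [eventually_ge_atTop 1] with n hn
    have : (0 : ℝ) < n := by exact_mod_cast hn
    exact Real.sqrt_pos.2 (by positivity)
  set γ' := Shamir.tolerance γ ω with hγ'def
  have hγ' : Tendsto γ' atTop (𝓝 0) := Shamir.tendsto_tolerance hγ hγpos hωlog
  have hθr : Tendsto (fun n => r * |θ n| / (c * ε)) atTop (𝓝 0) := by
    simpa using (hθabs.const_mul (r : ℝ)).div_const (c * ε)
  refine ⟨fun n => γ' n + |θ n| + r * |θ n| / (c * ε) + r / n + γ n, ?_, fun k => ?_⟩
  · simpa using (((hγ'.add hθabs).add hθr).add (hrdiv r)).add hγ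
  filter_upwards [hγpos, hγ'.eventually_le_const (show (0 : ℝ) < 1 by norm_num),
    hθabs.eventually_le_const (show (0 : ℝ) < 1 / 2 by norm_num),
    hθr.eventually_le_const (show (0 : ℝ) < 1 / 2 by norm_num),
    Shamir.eventually_tolerance_bound hγ hγpos hωlog
      (show (0 : ℝ) < c * ε / 4 by positivity) (k + 2),
    Shamir.tendsto_natCast_log.eventually_ge_atTop 1, eventually_ge_atTop (2 * r),
    hω.eventually_ge_atTop (2 * (k + 1) / η)]
    with n hγn hγ'n hθn hθrn hnum hlog hn hωn _ M δ hM _ t _ _ Z hZ x hx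
  have hn0 : (0 : ℝ) < n := by exact_mod_cast (by omega : 0 < n)
  have hn2 : (2 : ℝ) ≤ n := by exact_mod_cast (by omega : 2 ≤ n)
  have hn2r : (2 * r : ℝ) ≤ n := by exact_mod_cast hn
  have hMlow : Real.log n / 2 ≤ r * M / n := by
    have h1 := (abs_le.1 hM).1
    have h2 : θ n * (n / r * Real.log n) ≤ 1 / 2 * (n / r * Real.log n) := by
      gcongr
      exact (le_abs_self _).trans hθn
    rw [le_div_iff₀ hn0]
    have h3 : n / r * Real.log n / 2 ≤ M := by linarith
    calc Real.log n / 2 * n = r * (n / r * Real.log n / 2) := by field_simp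
      _ ≤ r * M := by gcongr
  have hMpos : 0 < M := by
    rw [Nat.pos_iff_ne_zero]
    rintro rfl
    rw [Nat.cast_zero, mul_zero, zero_div] at hMlow
    linarith
  set θ' := γ' n + |θ n| + r * |θ n| / (c * ε) + r / n + γ n with hθ'
  have hsq : γ n ^ 2 = |θ n| + 2 * r / n := Real.sq_sqrt (by positivity)
  have hγθ : r + |θ n| * ((n : ℝ) - r) ≤ γ n ^ 2 * ((n : ℝ) - r) := by
    rw [hsq, add_mul]
    have h1 : (2 * r / n : ℝ) * (n - r) = 2 * r - 2 * r * r / n := by field_simp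
    have h2 : (2 * r * r / n : ℝ) ≤ r := by
      rw [div_le_iff₀ hn0]
      nlinarith
    rw [h1]
    linarith
  have hγ'0 : 0 ≤ γ' n := Shamir.tolerance_nonneg γ ω n
  have hrare : (((Shamir.freeSamples n r M).filter
      (Shamir.SwapFailure r M t δ ε (θ n) C c (ω n) θ' Z x)).card : ℝ) ≤
      n * ((n : ℝ) ^ (k + 2))⁻¹ * (Shamir.samples r M δ).card := by
    refine Shamir.card_swapFailure_le fun s hs =>
      Shamir.card_act_swapFailure_le hε hc hZ hx (by omega) hMpos hγn hγ'0 hγ'n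
        (hθn.trans (by norm_num)) hθrn (by linarith) ?_ hγθ ?_ hs
    · have : 0 ≤ r * |θ n| / (c * ε) := by positivity
      have : 0 ≤ (r : ℝ) / n := by positivity
      have := abs_nonneg (θ n)
      linarith
    · intro S hS
      refine hnum S (le_trans ?_ hS)
      calc c * ε / 4 * Real.log n = c * ε * (Real.log n / 2) / 2 := by ring
        _ ≤ c * ε * (r * M / n) / 2 := by gcongr
  have hdef := Shamir.card_propR4_deficient_le (M := M) (t := t) (δ := δ) (ω := ω n) (η := η) hZ
  have hpow : (n : ℝ) ^ (-(η * ω n / 2)) ≤ ((n : ℝ) ^ (k + 1))⁻¹ := by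
    rw [← Real.rpow_natCast, ← Real.rpow_neg hn0.le]
    refine Real.rpow_le_rpow_of_exponent_le (by linarith) ?_
    rw [div_le_iff₀ hη] at hωn
    push_cast
    linarith
  have hpow2 : n * ((n : ℝ) ^ (k + 2))⁻¹ = ((n : ℝ) ^ (k + 1))⁻¹ := by
    rw [pow_succ (n : ℝ) (k + 1)]
    field_simp
  rw [hpow2] at hrare
  have hfin : ((n : ℝ) ^ (k + 1))⁻¹ + ((n : ℝ) ^ (k + 1))⁻¹ ≤ ((n : ℝ) ^ k)⁻¹ := by
    have : ((n : ℝ) ^ (k + 1))⁻¹ = ((n : ℝ) ^ k)⁻¹ * (n : ℝ)⁻¹ := by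
      rw [pow_succ, mul_inv]
    have h2 : (n : ℝ)⁻¹ ≤ 2⁻¹ := inv_anti₀ (by norm_num) hn2
    have h3 : 0 ≤ ((n : ℝ) ^ k)⁻¹ := by positivity
    rw [this]
    nlinarith
  unfold Shamir.prob
  refine div_le_of_le_mul₀ (by positivity) (by positivity) ?_
  -- Either the final hypergraph is deficient, or the failure is of the kind estimated on orbits.
  refine le_trans (Nat.cast_le.2 (Finset.card_le_card (t := ((Shamir.samples r M δ).filter fun s =>
    Shamir.PropR4 r M δ (ω n) η t (Shamir.graphAt r M t s) ∧
        Shamir.Deficient δ (ω n) Z (Shamir.graphAt r M (Shamir.stopT n r M) s)) ∪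
      (Shamir.freeSamples n r M).filter
        (Shamir.SwapFailure r M t δ ε (θ n) C c (ω n) θ' Z x)) ?_)) ?_
  · intro s hs
    obtain ⟨hs, hR, hF, hsw⟩ := (@Finset.mem_filter _ _ (_) _ _).1 hs
    rw [Finset.mem_union, Finset.mem_filter, Finset.mem_filter]
    by_cases hD : Shamir.Deficient δ (ω n) Z (Shamir.graphAt r M (Shamir.stopT n r M) s)
    · exact Or.inl ⟨hs, hR.r4, hD⟩
    · exact Or.inr ⟨(Shamir.mem_samples.1 hs).1, hs, hD, hR.r0, hF, hsw⟩
  · refine le_trans (Nat.cast_le.2 (Finset.card_union_le _ _)) ?_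
    push_cast
    have hcard : (0 : ℝ) ≤ (Shamir.samples r M δ).card := by positivity
    have h1 := mul_le_mul_of_nonneg_right hpow hcard
    have h2 := mul_le_mul_of_nonneg_right hfin hcard
    rw [add_mul] at h2
    have h3 := add_le_add (hdef.trans h1) hrare
    refine le_trans ?_ (h3.trans h2)
    convert le_refl _
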